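/- **Objects.** A collaborative object consists of a set of states with an initial state, a set of operations, a map $Do(s,op)=op(s)$, and preconditions saying which operations a site may generate in a given state. *Words* over an alphabet $\Sigma$: states are the words, initially empty; the operations are $InsCh(p,c)$ ($0\le p\le$ length), $DelCh(p)$ ($0\le p<$ length), $Nop()$; out of range they change nothing. *Trees* over a set of labels $\mathcal L\ni NoValue$: let $ID=\{data,mem\}\cup\mathbb N^2$. States are the well-formed trees, i.e. the finite unordered unranked edge-labelled trees $\{(\bot,data)(t_d),(\bot,mem)(t_m)\}$ (document and memory), where trees are given by $T::=\{(l_1,id_1)(T),\dots,(l_m,id_m)(T)\}$, $m\ge 0$, in which every identifier occurs at most once; the labels in $t_d,t_m$ are in $\mathcal L\cup\{\bot\}$. Initially $t_d=t_m=\{\}$. For $id\in\mathbb N^2$, $id_p\in ID$, $l\in\mathcal L$ the operations are: $Add(id_p,id)$ (put $(NoValue,id)(\{\})$ under $id_p$; no effect if $id$ already occurs), $Del(id)$ (erase the edge $id$ with the subtree below it and put that subtree under $mem$), $Mv(id,id_p)$ (erase the edge $id$ with the subtree below it and put both under $id_p$), $Ren(id,l)$ (relabel the edge $id$ by $l$),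 $Nop()$. Putting something under an absent identifier does nothing. Preconditions: $Add(id_p,id)$ is generated by site $i$ only with $id=(i,n)$ not used by it before in an $Add$, and with $id_p$ present; otherwise the identifiers mentioned (except in $Nop$) are present, and for $Mv(id,id_p)$ the identifier $id_p$ is neither $id$ nor below $id$. *XML-like documents*: pairs $(t,\delta)$ of a well-formed tree and a map $\delta$ from $ID$ to words over $\Sigma$, with $\delta(id)=\epsilon$ if $id$ does not occur in $t$. The operations are the tree operations, acting on $t$ (then $\delta$ is reset to $\epsilon$ off the identifiers of the new tree), and the operations $op_{id}$ ($id\in ID$, $op$ a word operation), replacing $\delta(id)$ by $op(\delta(id))$ when $id$ occurs in $t$ (precondition: $id$ occurs in $t$, and the precondition of $op$ on $\delta(id)$ holds). **Algorithms.** An editing algorithm for an object consists of a set $\mathcal Env$ of values of the local variables of one site, a set $\mathcal Req$ of requests, an initial environment for each site $i\in\mathbb N$, a map giving the copy of the object held in an environment, a local transition $\varphi_l(op,E)$, a request $r_l$ broadcast after it (depending on $op$ and the new environment), and a transition $\varphi_e(r,E)$ for external requests. A computation is a finite interleaving of local transitions (of operations satisfying their precondition) and external transitions at the sites; each site executes each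 external request at most once, and only after all requests that causally precede it, namely those generated or executed by the origin of the request before it generated the request. The algorithm is *convergent* if the initial copies are the initial state; a local transition always applies $op$ to the copy of its site; and in every computation any two sites that have processed all requests hold equal copies. It *loses no operation* if in every computation the copy of each site is the result of executing, from the initial state, all operations it has generated or received, each exactly once, in some order respecting causality. For a map $IT$ it *integrates concurrent operations by $IT$* if, whenever two requests carrying $op_1$ (from site $s_1$) and $op_2$ (from $s_2$) have the same causal predecessors, a site that has processed exactly these predecessors and $op_2$ and then receives $op_1$ changes its copy by executing $IT(op_1,op_2)$. Let $IT$ on tree operations be: $IT(Add(id_p,id),Del(id'))$ is $Nop()$ if $id=id'$, else $Add(mem,id)$ if $id_p=id'$; $IT(Mv(id,id_p),Del(id'))$ is $Mv(id,mem)$ if $id_p=id'$, else $Nop()$ if $id=id'$; $IT(Ren(id,l),Ren(id,l'))=Nop()$ and $IT(Mv(id,id_p),Mv(id,id_p'))=Nop()$ if $s_2<s_1$; and $IT(op_1,op_2)=op_1$ in all other cases. The *composition* of an algorithm $\mathcal A_T$ for trees and an algorithm $\mathcal A_D$ for words has as environments the pairs of an environment of $\mathcal A_T$ and a family $(E_{id})_{id\in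 ID}$ of environments of $\mathcal A_D$. Tree operations and their requests are handled by $\mathcal A_T$; operations $op_{id}$, with requests tagged by $id$, are handled by $\mathcal A_D$ in $E_{id}$. The copy is the tree held by $\mathcal A_T$, with the word held in $E_{id}$ at each $id$ occurring in it. **Theorem.** For every set $\mathcal L$ of labels with an element $NoValue$ and every alphabet $\Sigma$ there exist a convergent editing algorithm $\mathcal A_T$ for trees that loses no operation and integrates concurrent operations by $IT$, and a convergent editing algorithm $\mathcal A_D$ for words over $\Sigma$ that loses no operation, such that their composition is a convergent editing algorithm for XML-like documents. In particular, there exists a convergent editing algorithm for XML-like documents. -/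

import Mathlib

universe u

/-! Part 1: collaborative objects, editing algorithms, computations, convergence -/

/-- Sites are identified by their number; the set of sites is not fixed in advance. -/
abbrev Site := ℕ

/-- A collaborative object with operations `O` and states `S`.
`enabled i past s op` says that site `i`, having generated the operations in `past`, may generate
`op` on the state `s`: it is the precondition of the operation. -/
structure CollabObject (O S : Type u) where
  start : S
  exec : S → O → S
  enabled : Site → Set O → S → O → Prop

/-- Executing a history, first operation first. -/
def CollabObject.run {O S : Type u} (X : CollabObject O S) (s : S) (h : List O) : S :=
  h.foldl X.exec s

/-- An editing algorithm: the values `Env` of the local variables of one site, the requests `Req`,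
the initial environment of each site, the copy of the shared object held in an environment,
the transition for a local operation, the request that is then broadcast (computed from the
environment after the transition), and the transition for an external request. -/
structure EditingAlgorithm (O S : Type u) where
  Env : Type u
  Req : Type u
  start : Site → Env
  state : Env → S
  localStep : O → Env → Env
  request : O → Env → Req
  remoteStep : Req → Env → Env

/-- A request that has been broadcast, with its origin, the operation that it conveys, and (`deps`)
the names of all requests that its origin had generated or executed when it was generated. -/
structure Message (O Req : Type u) where
  origin : Site
  op : O
  req : Req
  deps : Set ℕ

namespace EditingAlgorithm

variable {O S : Type u}

/-- A global configuration. Requests are named by natural numbers (bookkeeping that the algorithm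
does not see); `done i` holds the names of the requests generated or executed by site `i`. -/
structure Config (A : EditingAlgorithm O S) where
  env : Site → A.Env
  sent : ℕ → Option (Message O A.Req)
  done : Site → Set ℕ

/-- The configuration in which nothing has happened. -/
def Config.initial (A : EditingAlgorithm O S) : A.Config where
  env := A.start
  sent := fun _ => none
  done := fun _ => ∅

/-- The operations generated by site `i` so far. -/
def Config.past {A : EditingAlgorithm O S} (c : A.Config) (i : Site) : Set O :=
  {o | ∃ k m, c.sent k = some m ∧ m.origin = i ∧ m.op = o}

/-- The causality relation: request `k` was generated or executed, by the site that generated `k'`,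
before `k'` was generated. -/
def Config.Precedes {A : EditingAlgorithm O S} (c : A.Config) (k k' : ℕ) : Prop :=
  ∃ m', c.sent k' = some m' ∧ k ∈ m'.deps

/-- Site `i` generates `op`, executes it, and broadcasts a request under a new name `k`. -/
def Config.generate {A : EditingAlgorithm O S} (c : A.Config) (i : Site) (op : O) (k : ℕ) :
    A.Config where
  env := Function.update c.env i (A.localStep op (c.env i))
  sent := Function.update c.sent k
    (some ⟨i, op, A.request op (A.localStep op (c.env i)), c.done i⟩)
  done := Function.update c.done i (insert k (c.done i))

/-- Site `j` executes the request of `m`, whose name is `k`. -/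
def Config.receive {A : EditingAlgorithm O S} (c : A.Config) (j : Site) (k : ℕ)
    (m : Message O A.Req) : A.Config where
  env := Function.update c.env j (A.remoteStep m.req (c.env j))
  sent := c.sent
  done := Function.update c.done j (insert k (c.done j))

/-- One step of a computation. External requests are executed once, in causal order. -/
inductive Step (X : CollabObject O S) (A : EditingAlgorithm O S) : A.Config → A.Config → Prop
  | generate (c : A.Config) (i : Site) (op : O) (k : ℕ) (fresh : c.sent k = none)
      (enabled : X.enabled i (c.past i) (A.state (c.env i)) op) :
      Step X A c (c.generate i op k)
  | receive (c : A.Config) (j : Site) (k : ℕ) (m : Message O A.Req) (sent : c.sent k = some m)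
      (new : k ∉ c.done j) (causal : m.deps ⊆ c.done j) :
      Step X A c (c.receive j k m)

/-- The configurations reached by finite computations. -/
def Reachable (X : CollabObject O S) (A : EditingAlgorithm O S) (c : A.Config) : Prop :=
  Relation.ReflTransGen (Step X A) (Config.initial A) c

/-- Site `i` has processed all requests. -/
def Config.Complete {A : EditingAlgorithm O S} (c : A.Config) (i : Site) : Prop :=
  ∀ k, c.sent k ≠ none → k ∈ c.done i

/-- `A` is a convergent editing algorithm on `X`: every site starts from the initial state of `X`,
a local operation is executed at once on the copy of its site, and sites that have processed all
requests share the same copy. -/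
structure Convergent (A : EditingAlgorithm O S) (X : CollabObject O S) : Prop where
  start_eq : ∀ i, A.state (A.start i) = X.start
  local_eq : ∀ c, Reachable X A c → ∀ i op, X.enabled i (c.past i) (A.state (c.env i)) op →
    A.state (A.localStep op (c.env i)) = X.exec (A.state (c.env i)) op
  agree : ∀ c, Reachable X A c → ∀ i j, c.Complete i → c.Complete j →
    A.state (c.env i) = A.state (c.env j)

/-- No operation is lost: the copy of a site is always the result of executing every operation that
this site has generated or received, each exactly once, in an order that respects causality. -/
def LosesNoOperation (A : EditingAlgorithm O S) (X : CollabObject O S) : Prop :=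
  ∀ c, Reachable X A c → ∀ i, ∃ l : List ℕ, l.Nodup ∧ (∀ k, k ∈ l ↔ k ∈ c.done i) ∧
    l.Pairwise (fun k k' => ¬ c.Precedes k' k) ∧
    A.state (c.env i) = X.run X.start (l.filterMap fun k => (c.sent k).map Message.op)

/-- Concurrent operations are integrated by `IT`: let `m` and `m'` be requests issued after the same
requests (hence concurrent and issued on the same state). A site that has processed these and `m'`
and now receives `m` executes the transform of the operation of `m` against that of `m'`. -/
def IntegratesBy (A : EditingAlgorithm O S) (X : CollabObject O S)
    (IT : Site → O → Site → O → O) : Prop :=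
  ∀ c, Reachable X A c → ∀ j k m k' m', c.sent k = some m → c.sent k' = some m' →
    m.deps = m'.deps → c.done j = insert k' m'.deps → k ∉ c.done j →
    A.state (A.remoteStep m.req (c.env j)) =
      X.exec (A.state (c.env j)) (IT m.origin m.op m'.origin m'.op)

end EditingAlgorithm

/-! Part 2: words -/

/-- Operations on words; `InsCh(p,c)`, `DelCh(p)`, `Nop()`. -/
inductive WordOp (Sym : Type u) : Type u
  | ins (p : ℕ) (c : Sym)
  | del (p : ℕ)
  | nop

/-- Outside its range of positions an operation changes nothing. -/
def WordOp.exec {Sym : Type u} (w : List Sym) : WordOp Sym → List Sym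
  | .ins p c => w.insertIdx p c
  | .del p => w.eraseIdx p
  | .nop => w

def WordOp.Enabled {Sym : Type u} (w : List Sym) : WordOp Sym → Prop
  | .ins p _ => p ≤ w.length
  | .del p => p < w.length
  | .nop => True

def wordObject (Sym : Type u) : CollabObject (WordOp Sym) (List Sym) where
  start := []
  exec := WordOp.exec
  enabled := fun _ _ w op => op.Enabled w

/-! Part 3: labelled unordered unranked trees with identifiers -/

/-- Identifiers: two reserved names, and the pairs (site number, operation number). -/
inductive Ident : Type
  | data
  | mem
  | node (id : ℕ × ℕ)
  deriving DecidableEq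

/-- Ordered presentations of trees: `cons l id s r` is the tree `r` with one more edge
`(l, id)` at the root, leading to `s`. The edge label `none` is the additional label `⊥`. -/
inductive Forest (Lab : Type u) : Type u
  | nil
  | cons (l : Option Lab) (id : Ident) (s r : Forest Lab)

namespace Forest

variable {Lab : Type u}

/-- Equality of trees up to the order of siblings, at all depths. -/
inductive Equiv : Forest Lab → Forest Lab → Prop
  | refl (t) : Equiv t t
  | symm {s t} : Equiv s t → Equiv t s
  | trans {s t r} : Equiv s t → Equiv t r → Equiv s r
  | cons (l id) {s s' r r'} : Equiv s s' → Equiv r r' → Equiv (cons l id s r) (cons l id s' r')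
  | swap (l id s l' id' s' r) :
      Equiv (cons l id s (cons l' id' s' r)) (cons l' id' s' (cons l id s r))

instance setoid (Lab : Type u) : Setoid (Forest Lab) where
  r := Equiv
  iseqv := ⟨Equiv.refl, Equiv.symm, Equiv.trans⟩

/-- Union of two trees (joined at the root). -/
def union : Forest Lab → Forest Lab → Forest Lab
  | nil, t => t
  | cons l i s r, t => cons l i s (union r t)

/-- All identifiers, with multiplicity. -/
def ids : Forest Lab → Multiset Ident
  | nil => 0
  | cons _ i s r => i ::ₘ (ids s + ids r)

/-- Delete the edge with identifier `id` and everything below it. -/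
def erase (id : Ident) : Forest Lab → Forest Lab
  | nil => nil
  | cons l i s r => if i = id then erase id r else cons l i (erase id s) (erase id r)

/-- The tree below the edge with identifier `id`. -/
def proj (id : Ident) : Forest Lab → Forest Lab
  | nil => nil
  | cons _ i s r => if i = id then union s (proj id r) else union (proj id s) (proj id r)

/-- The edge with identifier `id` together with the tree below it. -/
def projEdge (id : Ident) : Forest Lab → Forest Lab
  | nil => nil
  | cons l i s r => if i = id then cons l i s (projEdge id r)
      else union (projEdge id s) (projEdge id r)

/-- Add the tree `s₀` under the edge with identifier `p`. -/
def addTree (p : Ident) (s₀ : Forest Lab) : Forest Lab → Forest Lab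
  | nil => nil
  | cons l i s r => if i = p then cons l i (union s s₀) (addTree p s₀ r)
      else cons l i (addTree p s₀ s) (addTree p s₀ r)

/-- Change the label of the edge with identifier `id`. -/
def rename (id : Ident) (l₀ : Lab) : Forest Lab → Forest Lab
  | nil => nil
  | cons l i s r => if i = id then cons (some l₀) i s (rename id l₀ r)
      else cons l i (rename id l₀ s) (rename id l₀ r)

theorem union_assoc (a b c : Forest Lab) : union (union a b) c = union a (union b c) := by
  induction a with
  | nil => rfl
  | cons l i s r _ ih => simp [union, ih]

theorem union_congr_right (a : Forest Lab) {b b' : Forest Lab} (h : Equiv b b') :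
    Equiv (union a b) (union a b') := by
  induction a with
  | nil => exact h
  | cons l i s r _ ih => exact .cons l i (.refl s) ih

theorem union_congr_left {a a' : Forest Lab} (h : Equiv a a') (b : Forest Lab) :
    Equiv (union a b) (union a' b) := by
  induction h with
  | refl t => exact .refl _
  | symm _ ih => exact ih.symm
  | trans _ _ ih₁ ih₂ => exact ih₁.trans ih₂
  | cons l i hs _ _ ih => exact .cons l i hs ih
  | swap => exact .swap ..

theorem union_congr {a a' b b' : Forest Lab} (h : Equiv a a') (h' : Equiv b b') :
    Equiv (union a b) (union a' b') :=
  (union_congr_left h b).trans (union_congr_right a' h')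

theorem union_cons (a : Forest Lab) (l i s) (b : Forest Lab) :
    Equiv (union a (cons l i s b)) (cons l i s (union a b)) := by
  induction a with
  | nil => exact .refl _
  | cons l' i' s' r' _ ih => exact (Equiv.cons l' i' (.refl s') ih).trans (.swap ..)

theorem union_left_comm (a b c : Forest Lab) :
    Equiv (union a (union b c)) (union b (union a c)) := by
  induction a with
  | nil => exact .refl _
  | cons l i s r _ ih => exact (Equiv.cons l i (.refl s) ih).trans (union_cons b l i s _).symm

theorem ids_congr {s t : Forest Lab} (h : Equiv s t) : ids s = ids t := by
  induction h with
  | refl => rfl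
  | symm _ ih => exact ih.symm
  | trans _ _ ih₁ ih₂ => exact ih₁.trans ih₂
  | cons l i _ _ ih₁ ih₂ => simp [ids, ih₁, ih₂]
  | swap l i s l' i' s' r =>
    simp only [ids, Multiset.add_cons]
    rw [Multiset.cons_swap, ← add_assoc, ← add_assoc, add_comm (ids s)]

theorem erase_congr (id : Ident) {s t : Forest Lab} (h : Equiv s t) :
    Equiv (erase id s) (erase id t) := by
  induction h with
  | refl => exact .refl _
  | symm _ ih => exact ih.symm
  | trans _ _ ih₁ ih₂ => exact ih₁.trans ih₂
  | cons l i _ _ ih₁ ih₂ =>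
    by_cases h : i = id
    · simpa [erase, h] using ih₂
    · simpa [erase, h] using Equiv.cons l i ih₁ ih₂
  | swap l i s l' i' s' r =>
    by_cases h : i = id <;> by_cases h' : i' = id <;> simp only [erase, h, h', if_true, if_false]
    · exact .refl _
    · exact .refl _
    · exact .refl _
    · exact .swap ..

theorem proj_congr (id : Ident) {s t : Forest Lab} (h : Equiv s t) :
    Equiv (proj id s) (proj id t) := by
  induction h with
  | refl => exact .refl _
  | symm _ ih => exact ih.symm
  | trans _ _ ih₁ ih₂ => exact ih₁.trans ih₂
  | cons l i hs _ ih₁ ih₂ =>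
    by_cases h : i = id
    · simpa [proj, h] using union_congr hs ih₂
    · simpa [proj, h] using union_congr ih₁ ih₂
  | swap l i s l' i' s' r =>
    by_cases h : i = id <;> by_cases h' : i' = id <;> simp only [proj, h, h', if_true, if_false]
    all_goals exact union_left_comm _ _ _

theorem projEdge_congr (id : Ident) {s t : Forest Lab} (h : Equiv s t) :
    Equiv (projEdge id s) (projEdge id t) := by
  induction h with
  | refl => exact .refl _
  | symm _ ih => exact ih.symm
  | trans _ _ ih₁ ih₂ => exact ih₁.trans ih₂
  | cons l i hs _ ih₁ ih₂ =>
    by_cases h : i = id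
    · simpa [projEdge, h] using Equiv.cons l id hs ih₂
    · simpa [projEdge, h] using union_congr ih₁ ih₂
  | swap l i s l' i' s' r =>
    by_cases h : i = id <;> by_cases h' : i' = id <;>
      simp only [projEdge, h, h', if_true, if_false]
    · exact .swap ..
    · exact (union_cons _ _ _ _ _).symm
    · exact union_cons _ _ _ _ _
    · exact union_left_comm _ _ _

theorem addTree_congr (p : Ident) {a b s t : Forest Lab} (hab : Equiv a b) (h : Equiv s t) :
    Equiv (addTree p a s) (addTree p b t) := by
  have key : ∀ u : Forest Lab, Equiv (addTree p a u) (addTree p b u) := by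
    intro u
    induction u with
    | nil => exact .refl _
    | cons l i s r ih₁ ih₂ =>
      by_cases h : i = p
      · simpa [addTree, h] using Equiv.cons l p (union_congr_right s hab) ih₂
      · simpa [addTree, h] using Equiv.cons l i ih₁ ih₂
  induction h with
  | refl t => exact key t
  | @symm s t _ ih => exact (key t).trans (ih.symm.trans (key s))
  | @trans s t r _ _ ih₁ ih₂ => exact ih₁.trans ((key t).symm.trans ih₂)
  | cons l i hs _ ih₁ ih₂ =>
    by_cases h : i = p
    · simpa [addTree, h] using Equiv.cons l p (union_congr hs hab) ih₂
    · simpa [addTree, h] using Equiv.cons l i ih₁ ih₂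
  | swap l i s l' i' s' r =>
    refine Equiv.trans ?_ (key _)
    by_cases h : i = p <;> by_cases h' : i' = p <;>
      simp only [addTree, h, h', if_true, if_false] <;> exact .swap ..

theorem rename_congr (id : Ident) (l₀ : Lab) {s t : Forest Lab} (h : Equiv s t) :
    Equiv (rename id l₀ s) (rename id l₀ t) := by
  induction h with
  | refl => exact .refl _
  | symm _ ih => exact ih.symm
  | trans _ _ ih₁ ih₂ => exact ih₁.trans ih₂
  | cons l i hs _ ih₁ ih₂ =>
    by_cases h : i = id
    · simpa [rename, h] using Equiv.cons (some l₀) id hs ih₂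
    · simpa [rename, h] using Equiv.cons l i ih₁ ih₂
  | swap l i s l' i' s' r =>
    by_cases h : i = id <;> by_cases h' : i' = id <;>
      simp only [rename, h, h', if_true, if_false] <;> exact .swap ..

theorem ids_union (a b : Forest Lab) : ids (union a b) = ids a + ids b := by
  induction a with
  | nil => simp [union, ids]
  | cons l i s r _ ih => simp [union, ids, ih, add_assoc]

theorem ids_erase_add (id : Ident) (t : Forest Lab) :
    ids (erase id t) + ids (projEdge id t) = ids t := by
  induction t with
  | nil => simp [erase, projEdge, ids]
  | cons l i s r ih₁ ih₂ =>
    by_cases h : i = id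
    · simp only [erase, projEdge, h, if_true, ids, Multiset.add_cons]
      rw [add_left_comm, ih₂]
    · simp only [erase, projEdge, h, if_false, ids, ids_union, Multiset.cons_add]
      rw [add_add_add_comm, ih₁, ih₂]

theorem ids_proj_le (id : Ident) (t : Forest Lab) : ids (proj id t) ≤ ids (projEdge id t) := by
  induction t with
  | nil => exact le_rfl
  | cons l i s r ih₁ ih₂ =>
    by_cases h : i = id
    · simp only [proj, projEdge, h, if_true, ids, ids_union]
      exact (add_le_add_right ih₂ _).trans (Multiset.le_cons_self _ _)
    · simp only [proj, projEdge, h, if_false, ids_union]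
      exact add_le_add ih₁ ih₂

theorem ids_rename (id : Ident) (l₀ : Lab) (t : Forest Lab) : ids (rename id l₀ t) = ids t := by
  induction t with
  | nil => rfl
  | cons l i s r ih₁ ih₂ => by_cases h : i = id <;> simp [rename, ids, h, ih₁, ih₂]

theorem ids_addTree_le (p : Ident) (s₀ t : Forest Lab) :
    ids (addTree p s₀ t) ≤ ids t + (ids t).count p • ids s₀ := by
  induction t with
  | nil => exact Multiset.zero_le _
  | cons l i s r ih₁ ih₂ =>
    by_cases h : i = p
    · subst h
      simp only [addTree, if_true, ids, ids_union, Multiset.count_cons_self, Multiset.count_add,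
        Multiset.cons_add]
      refine (Multiset.cons_le_cons_iff i).2 ((add_le_add_right ih₂ _).trans ?_)
      have e : ids s + ids r + ((ids s).count i + (ids r).count i + 1) • ids s₀ =
          (ids s + ids s₀ + (ids r + (ids r).count i • ids s₀)) + (ids s).count i • ids s₀ := by
        rw [add_smul, add_smul, one_smul]; abel
      rw [e]
      exact Multiset.le_add_right _ _
    · simp only [addTree, h, if_false, ids, Multiset.count_add, Multiset.cons_add,
        Multiset.count_cons_of_ne (Ne.symm h)]
      refine (Multiset.cons_le_cons_iff i).2 ((add_le_add ih₁ ih₂).trans (le_of_eq ?_))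
      rw [add_smul]; abel

theorem nodup_addTree (p : Ident) {s₀ t : Forest Lab} (h : (ids t + ids s₀).Nodup) :
    (ids (addTree p s₀ t)).Nodup := by
  have h1 : (ids t).count p ≤ 1 :=
    Multiset.nodup_iff_count_le_one.1 (Multiset.nodup_of_le (Multiset.le_add_right _ _) h) p
  refine Multiset.nodup_of_le ((ids_addTree_le p s₀ t).trans ?_) h
  interval_cases (ids t).count p <;> simp

end Forest

/-- Unordered trees `{(l₁,id₁)(t₁), ..., (lₘ,idₘ)(tₘ)}`. -/
abbrev UTree (Lab : Type u) := Quotient (Forest.setoid Lab)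

namespace UTree

variable {Lab : Type u}

def ids (t : UTree Lab) : Multiset Ident :=
  Quotient.lift Forest.ids (fun _ _ h => Forest.ids_congr h) t

def erase (id : Ident) (t : UTree Lab) : UTree Lab :=
  Quotient.map (Forest.erase id) (fun _ _ h => Forest.erase_congr id h) t

def proj (id : Ident) (t : UTree Lab) : UTree Lab :=
  Quotient.map (Forest.proj id) (fun _ _ h => Forest.proj_congr id h) t

def projEdge (id : Ident) (t : UTree Lab) : UTree Lab :=
  Quotient.map (Forest.projEdge id) (fun _ _ h => Forest.projEdge_congr id h) t

def addTree (p : Ident) (s t : UTree Lab) : UTree Lab :=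
  Quotient.map₂ (Forest.addTree p) (fun _ _ h _ _ h' => Forest.addTree_congr p h h') s t

def rename (id : Ident) (l : Lab) (t : UTree Lab) : UTree Lab :=
  Quotient.map (Forest.rename id l) (fun _ _ h => Forest.rename_congr id l h) t

/-- The tree `{(l,id)({})}`. -/
def leaf (l : Lab) (id : Ident) : UTree Lab := ⟦.cons (some l) id .nil .nil⟧

/-- The tree `{(⊥,data)(d), (⊥,mem)(m)}`: the document and the memory. -/
def glue (d m : Forest Lab) : UTree Lab := ⟦.cons none .data d (.cons none .mem m .nil)⟧

/-- Well-formed trees: a document and a memory, each identifier occurring once. -/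
def WellFormed (t : UTree Lab) : Prop := (∃ d m, t = glue d m) ∧ t.ids.Nodup

end UTree

/-- The states: well-formed trees. -/
abbrev XTree (Lab : Type u) := {t : UTree Lab // t.WellFormed}

/-- The set of identifiers that occur in a tree. -/
def XTree.dom {Lab : Type u} (t : XTree Lab) : Set Ident := {id | id ∈ t.1.ids}

/-- Operations on trees. A node that is added, deleted, moved or renamed is never one of the two
reserved ones. -/
inductive TreeOp (Lab : Type u) : Type u
  | add (p : Ident) (id : ℕ × ℕ)
  | del (id : ℕ × ℕ)
  | mv (id : ℕ × ℕ) (p : Ident)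
  | ren (id : ℕ × ℕ) (l : Lab)
  | nop

namespace TreeOp

variable {Lab : Type u}

/-- The effect of an operation. An identifier is created only once, so adding one that already
occurs changes nothing. Deleting a node stores what is below it in the memory. -/
def apply (noValue : Lab) (t : UTree Lab) : TreeOp Lab → UTree Lab
  | add p id => if .node id ∈ t.ids then t else UTree.addTree p (UTree.leaf noValue (.node id)) t
  | del id => UTree.addTree .mem (UTree.proj (.node id) t) (UTree.erase (.node id) t)
  | mv id p => UTree.addTree p (UTree.projEdge (.node id) t) (UTree.erase (.node id) t)
  | ren id l => UTree.rename (.node id) l t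
  | nop => t

theorem glue_addTree (p : Ident) (s : UTree Lab) (d m : Forest Lab) :
    ∃ d' m', UTree.addTree p s (UTree.glue d m) = UTree.glue d' m' := by
  induction s using Quotient.inductionOn with | h s =>
  refine ⟨if Ident.data = p then d.union s else Forest.addTree p s d,
    if Ident.mem = p then m.union s else Forest.addTree p s m, ?_⟩
  change (⟦Forest.addTree p s (.cons none .data d (.cons none .mem m .nil))⟧ : UTree Lab) = _
  cases p <;> simp [Forest.addTree, UTree.glue]

theorem apply_wellFormed (noValue : Lab) {t : UTree Lab} (ht : t.WellFormed) (op : TreeOp Lab) :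
    (apply noValue t op).WellFormed := by
  obtain ⟨⟨d, m, rfl⟩, hn⟩ := ht
  have hn' : (Forest.ids (.cons none .data d (.cons none .mem m .nil))).Nodup := hn
  have herase : ∀ id : ℕ × ℕ, UTree.erase (.node id) (UTree.glue d m) =
      UTree.glue (d.erase (.node id)) (m.erase (.node id)) := fun _ => rfl
  cases op with
  | add p id =>
    by_cases h : Ident.node id ∈ (UTree.glue d m).ids
    · simp only [apply, h, if_true]
      exact ⟨⟨d, m, rfl⟩, hn⟩
    · simp only [apply, h, if_false]
      refine ⟨glue_addTree _ _ _ _, Forest.nodup_addTree p ?_⟩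
      have h' : Ident.node id ∉ Forest.ids (.cons none .data d (.cons none .mem m .nil)) := h
      rw [show Forest.ids (.cons (some noValue) (.node id) .nil .nil) = {Ident.node id} from rfl]
      exact Multiset.nodup_add.2 ⟨hn', Multiset.nodup_singleton _,
        Multiset.disjoint_singleton.2 h'⟩
  | del id =>
    refine ⟨?_, Forest.nodup_addTree .mem ?_⟩
    · simp only [apply, herase]; exact glue_addTree _ _ _ _
    · refine Multiset.nodup_of_le ?_ hn'
      exact (add_le_add_right (Forest.ids_proj_le _ _) _).trans_eq (Forest.ids_erase_add _ _)
  | mv id p =>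
    refine ⟨?_, Forest.nodup_addTree p ?_⟩
    · simp only [apply, herase]; exact glue_addTree _ _ _ _
    · rw [Forest.ids_erase_add]; exact hn'
  | ren id l =>
    refine ⟨⟨d.rename (.node id) l, m.rename (.node id) l, rfl⟩, ?_⟩
    change (Forest.ids (Forest.rename _ _ _)).Nodup
    rw [Forest.ids_rename]; exact hn'
  | nop => exact ⟨⟨d, m, rfl⟩, hn⟩

/-- Preconditions: site `i` creates identifiers `(i, n)`, each of them once; the nodes mentioned
exist; a node is not moved below itself. -/
def Enabled (i : Site) (past : Set (TreeOp Lab)) (t : XTree Lab) : TreeOp Lab → Prop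
  | add p id => id.1 = i ∧ (∀ q, add q id ∉ past) ∧ p ∈ t.dom
  | del id => .node id ∈ t.dom
  | mv id p => .node id ∈ t.dom ∧ p ∈ t.dom ∧ p ∉ (UTree.projEdge (.node id) t.1).ids
  | ren id _ => .node id ∈ t.dom
  | nop => True

/-- The integration transformation: `IT s₁ o₁ s₂ o₂` transforms the operation `o₁` of site `s₁`
against the concurrent operation `o₂` of site `s₂`. -/
def IT (s₁ : Site) (o₁ : TreeOp Lab) (s₂ : Site) (o₂ : TreeOp Lab) : TreeOp Lab :=
  match o₁, o₂ with
  | add p id, del id' =>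
      if id = id' then nop else if p = .node id' then add .mem id else add p id
  | ren id l, ren id' _ => if s₂ < s₁ ∧ id = id' then nop else ren id l
  | mv id p, mv id' _ => if s₂ < s₁ ∧ id = id' then nop else mv id p
  | mv id p, del id' =>
      if p = .node id' then mv id .mem else if id = id' then nop else mv id p
  | o, _ => o

end TreeOp

/-- The collaborative object of trees; the initial tree has an empty document and memory. -/
def treeObject {Lab : Type u} (noValue : Lab) : CollabObject (TreeOp Lab) (XTree Lab) where
  start := ⟨UTree.glue .nil .nil, ⟨_, _, rfl⟩, by
    change (Forest.ids (.cons none .data .nil (.cons none .mem .nil .nil)) :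
      Multiset Ident).Nodup
    simp [Forest.ids]⟩
  exec := fun t op => ⟨TreeOp.apply noValue t.1 op, TreeOp.apply_wellFormed noValue t.2 op⟩
  enabled := TreeOp.Enabled

/-! Part 4: trees decorated with data, and the composition of algorithms -/

/-- A tree decorated with an element of `D` at each identifier that occurs in it; other identifiers
carry the default value `d₀`. -/
@[ext]
structure DecoratedTree (Lab D : Type u) (d₀ : D) where
  tree : XTree Lab
  label : Ident → D
  label_default : ∀ id, id ∉ tree.dom → label id = d₀

open Classical in
/-- The decorated tree with a given tree and given values on its identifiers. -/
noncomputable def decorate {Lab D : Type u} (d₀ : D) (t : XTree Lab) (δ : Ident → D) :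
    DecoratedTree Lab D d₀ where
  tree := t
  label := fun id => if id ∈ t.dom then δ id else d₀
  label_default := fun _ h => if_neg h

/-- Operations on decorated trees: tree operations, and operations on the value at an
identifier. -/
abbrev DecoratedOp (Lab OD : Type u) := TreeOp Lab ⊕ (Ident × OD)

/-- Trees parameterized by the collaborative object `Y`. -/
noncomputable def decoratedObject {Lab OD D : Type u} (noValue : Lab) (Y : CollabObject OD D) :
    CollabObject (DecoratedOp Lab OD) (DecoratedTree Lab D Y.start) where
  start := decorate Y.start (treeObject noValue).start (fun _ => Y.start)
  exec := fun s op => match op with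
    | .inl o => decorate Y.start ((treeObject noValue).exec s.tree o) s.label
    | .inr (id, o) =>
        decorate Y.start s.tree (Function.update s.label id (Y.exec (s.label id) o))
  enabled := fun i past s op => match op with
    | .inl o => (treeObject noValue).enabled i {o' | .inl o' ∈ past} s.tree o
    | .inr (id, o) => id ∈ s.tree.dom ∧ Y.enabled i {o' | .inr (id, o') ∈ past} (s.label id) o

/-- The composition of an algorithm for trees with an algorithm for the data: one environment for
the tree, one for each identifier (in its initial value as long as nothing concerning that
identifier has been executed). -/
noncomputable def EditingAlgorithm.compose {Lab OD D : Type u}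
    (AT : EditingAlgorithm (TreeOp Lab) (XTree Lab)) (AD : EditingAlgorithm OD D) (d₀ : D) :
    EditingAlgorithm (DecoratedOp Lab OD) (DecoratedTree Lab D d₀) where
  Env := AT.Env × (Ident → AD.Env)
  Req := AT.Req ⊕ (Ident × AD.Req)
  start := fun i => (AT.start i, fun _ => AD.start i)
  state := fun E => decorate d₀ (AT.state E.1) (fun id => AD.state (E.2 id))
  localStep := fun op E => match op with
    | .inl o => (AT.localStep o E.1, E.2)
    | .inr (id, o) => (E.1, Function.update E.2 id (AD.localStep o (E.2 id)))
  request := fun op E => match op with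
    | .inl o => .inl (AT.request o E.1)
    | .inr (id, o) => .inr (id, AD.request o (E.2 id))
  remoteStep := fun r E => match r with
    | .inl r => (AT.remoteStep r E.1, E.2)
    | .inr (id, r) => (E.1, Function.update E.2 id (AD.remoteStep r (E.2 id)))

/-- XML-like documents: trees decorated with strings over `Sym`. -/
noncomputable def documentObject {Lab : Type u} (noValue : Lab) (Sym : Type u) :
    CollabObject (DecoratedOp Lab (WordOp Sym)) (DecoratedTree Lab (List Sym) []) :=
  decoratedObject noValue (wordObject Sym)

/-!
Both algorithms are instances of one construction, the replay algorithm. Every site keeps the log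
of all operations that it has generated or received, and its copy is the result of executing the
log from the initial state. Logs are sorted by Lamport clock, then by a rank of the operation, then
by decreasing site number. A local operation gets a clock larger than all clocks of the log, hence
comes last and is executed directly on the copy; the order extends causality; and the log depends
only on the set of operations known to the site. This yields convergence (`replay_convergent`) and
that no operation is lost (`replay_losesNoOperation`), for any object and any rank.

Two requests with the same causal predecessors get the same clock. A site that has executed exactly
these predecessors and one of the two requests therefore has to execute both on the common copy on
which they were generated, in the order of ranks and sites (`ReplayInv.remoteStep_eq`). If deletions
get a larger rank than all other operations, the transformation `IT` does exactly this for trees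
(`TreeOp.apply_IT_of_before`): most pairs of operations commute, what is added or moved below a
deleted edge ends up in the memory, moving the deleted edge itself has no effect, and of two moves
or two renamings of the same edge the one of the smaller site number comes last. Equalities of trees
are checked on the parents and labels of edges, which determine a well-formed tree
(`UTree.WellFormed.ext`). The delicate pair is that of two moves of different edges: they commute even if together they would close a cycle, since then either
order erases both subtrees (`TreeOp.edge_mv_mv`).

Finally, any two convergent algorithms without lost operations compose to a convergent algorithm
(`EditingAlgorithm.Convergent.compose`): a computation of the composition projects to a computation
of the tree algorithm and, for each identifier, to one of the data algorithm
(`IsProjection.exists_of_reachable`). The one interaction is that a freshly added identifier must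
carry the default datum; it does, because data are edited only at identifiers that occur, and these
have been added before.
-/

/-! ### Replaying a log in timestamp order -/

/-- A timestamped operation: the Lamport clock of its generation, the generating site, and the
operation itself. It serves both as the request that is broadcast and as the entry of a log. -/
structure LogEntry (O : Type u) : Type u where
  clock : ℕ
  site : Site
  op : O

namespace LogEntry

variable {O : Type u}

/-- The position of an entry in the execution order: by clock, then by the rank of its operation,
then by decreasing site number, so that among concurrent operations of the same rank with equal
clocks the one of the smallest site is executed last. -/
def key (rank : O → ℕ) (e : LogEntry O) : ℕ ×ₗ ℕ ×ₗ ℕᵒᵈ :=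
  toLex (e.clock, toLex (rank e.op, OrderDual.toDual e.site))

theorem key_lt_of_clock_lt (rank : O → ℕ) {a b : LogEntry O} (h : a.clock < b.clock) :
    a.key rank < b.key rank :=
  Prod.Lex.toLex_lt_toLex.2 (.inl h)

theorem key_lt_iff_of_clock_eq {rank : O → ℕ} {a b : LogEntry O} (h : a.clock = b.clock) :
    a.key rank < b.key rank ↔
      rank a.op < rank b.op ∨ rank a.op = rank b.op ∧ b.site < a.site := by
  simp [key, Prod.Lex.toLex_lt_toLex, h]

theorem clock_site_eq_of_key_eq {rank : O → ℕ} {a b : LogEntry O}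
    (h : a.key rank = b.key rank) : a.clock = b.clock ∧ a.site = b.site := by
  simp only [key, EmbeddingLike.apply_eq_iff_eq, Prod.mk.injEq] at h
  exact ⟨h.1, h.2.2⟩

/-- The largest clock in a log. -/
def maxClock (l : List (LogEntry O)) : ℕ := l.foldr (fun e n => max e.clock n) 0

theorem clock_le_maxClock {l : List (LogEntry O)} {e : LogEntry O} (h : e ∈ l) :
    e.clock ≤ maxClock l := by
  induction l with
  | nil => simp at h
  | cons a l ih =>
    rcases List.mem_cons.1 h with rfl | h
    · exact le_max_left _ _
    · exact (ih h).trans (le_max_right _ _)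

theorem maxClock_append_singleton (l : List (LogEntry O)) (e : LogEntry O) :
    maxClock (l ++ [e]) = max (maxClock l) e.clock := by
  induction l with
  | nil => simp [maxClock]
  | cons a l ih => simp only [maxClock, List.cons_append, List.foldr_cons] at ih ⊢; omega

/-- Insert an entry at its place in the execution order. -/
def insert (rank : O → ℕ) (e : LogEntry O) (l : List (LogEntry O)) : List (LogEntry O) :=
  l.orderedInsert (fun a b => a.key rank < b.key rank) e

theorem pairwise_insert {rank : O → ℕ} {e : LogEntry O} {l : List (LogEntry O)}
    (hl : l.Pairwise fun a b => a.key rank < b.key rank) (he : ∀ a ∈ l, a.key rank ≠ e.key rank) :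
    (insert rank e l).Pairwise fun a b => a.key rank < b.key rank := by
  induction l with
  | nil => simp [insert]
  | cons a l ih =>
    simp only [insert, List.orderedInsert_cons]
    rw [List.pairwise_cons] at hl
    split_ifs with h
    · refine List.pairwise_cons.2 ⟨fun b hb => ?_, List.pairwise_cons.2 hl⟩
      rcases List.mem_cons.1 hb with rfl | hb
      · exact h
      · exact h.trans (hl.1 b hb)
    · refine List.pairwise_cons.2 ⟨fun b hb => ?_, ih hl.2 fun b hb => he b (by simp [hb])⟩
      rcases (List.mem_orderedInsert _).1 hb with rfl | hb
      · exact lt_of_le_of_ne (not_lt.1 h) (he a (by simp))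
      · exact hl.1 b hb

end LogEntry

/-- The local variables of a site of the replay algorithm: its number, and the log of all
operations that it has generated or received, in execution order. -/
structure LogEnv (O : Type u) : Type u where
  site : Site
  log : List (LogEntry O)

/-- The result of executing a log. -/
def CollabObject.replay {O S : Type u} (X : CollabObject O S) (l : List (LogEntry O)) : S :=
  X.run X.start (l.map LogEntry.op)

theorem CollabObject.replay_append_singleton {O S : Type u} (X : CollabObject O S)
    (l : List (LogEntry O)) (e : LogEntry O) :
    X.replay (l ++ [e]) = X.exec (X.replay l) e.op := by
  simp [CollabObject.replay, CollabObject.run]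

namespace EditingAlgorithm

variable {O S : Type u}

/-- The replay algorithm: every site keeps the log of all operations known to it, sorted by
timestamps, and its copy is the result of executing that log. A local operation gets a clock
exceeding all clocks of the log, so that it comes last. -/
def replay (X : CollabObject O S) (rank : O → ℕ) : EditingAlgorithm O S where
  Env := LogEnv O
  Req := LogEntry O
  start := fun i => ⟨i, []⟩
  state := fun E => X.replay E.log
  localStep := fun op E => ⟨E.site, E.log ++ [⟨LogEntry.maxClock E.log + 1, E.site, op⟩]⟩
  request := fun op E => ⟨LogEntry.maxClock E.log, E.site, op⟩
  remoteStep := fun r E => ⟨E.site, LogEntry.insert rank r E.log⟩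

variable {X : CollabObject O S} {rank : O → ℕ}

/-- `l` is the list, in execution order, of the requests with names in `D`, all of which have been
sent. Such a list is unique, because the order is strict. -/
structure IsLog (rank : O → ℕ) (sent : ℕ → Option (Message O (LogEntry O))) (D : Set ℕ)
    (l : List (LogEntry O)) : Prop where
  sorted : l.Pairwise fun a b => a.key rank < b.key rank
  isSome : ∀ k ∈ D, sent k ≠ none
  mem_iff : ∀ e, e ∈ l ↔ ∃ k ∈ D, ∃ m, sent k = some m ∧ m.req = e

namespace IsLog

variable {sent : ℕ → Option (Message O (LogEntry O))} {D : Set ℕ} {l l' : List (LogEntry O)}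

theorem unique (h : IsLog rank sent D l) (h' : IsLog rank sent D l') : l = l' := by
  have : Std.Antisymm fun a b : LogEntry O => a.key rank < b.key rank :=
    ⟨fun a b h h' => absurd h (lt_asymm h')⟩
  have : Std.Irrefl fun a b : LogEntry O => a.key rank < b.key rank :=
    ⟨fun a => lt_irrefl _⟩
  exact h.sorted.eq_of_mem_iff h'.sorted fun e => (h.mem_iff e).trans (h'.mem_iff e).symm

theorem update {k : ℕ} (h : IsLog rank sent D l) (hk : sent k = none)
    (m : Option (Message O (LogEntry O))) : IsLog rank (Function.update sent k m) D l := by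
  have ne : ∀ k' ∈ D, k' ≠ k := fun k' hk' e => h.isSome k' hk' (e ▸ hk)
  refine ⟨h.sorted, fun k' hk' => ?_, fun e => (h.mem_iff e).trans ?_⟩
  · rw [Function.update_of_ne (ne k' hk')]; exact h.isSome k' hk'
  · refine exists_congr fun k' => and_congr_right fun hk' => ?_
    rw [Function.update_of_ne (ne k' hk')]

theorem mem_iff_insert {k : ℕ} {m : Message O (LogEntry O)} (h : IsLog rank sent D l)
    (hm : sent k = some m) (e : LogEntry O) :
    (∃ k' ∈ Insert.insert k D, ∃ m', sent k' = some m' ∧ m'.req = e) ↔ e = m.req ∨ e ∈ l := by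
  rw [h.mem_iff]
  simp [hm, eq_comm]

theorem isSome_insert {k : ℕ} {m : Message O (LogEntry O)} (h : IsLog rank sent D l)
    (hm : sent k = some m) : ∀ k' ∈ Insert.insert k D, sent k' ≠ none := by
  rintro k' (rfl | hk')
  · simp [hm]
  · exact h.isSome k' hk'

theorem append {k : ℕ} {m : Message O (LogEntry O)} (h : IsLog rank sent D l)
    (hm : sent k = some m) (hlt : ∀ a ∈ l, a.key rank < m.req.key rank) :
    IsLog rank sent (Insert.insert k D) (l ++ [m.req]) := by
  refine ⟨?_, h.isSome_insert hm, fun e => ?_⟩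
  · rw [List.pairwise_append]
    exact ⟨h.sorted, List.pairwise_singleton _ _, by simpa using hlt⟩
  · rw [h.mem_iff_insert hm]; simp [or_comm]

theorem insert {k : ℕ} {m : Message O (LogEntry O)} (h : IsLog rank sent D l)
    (hm : sent k = some m) (hne : ∀ a ∈ l, a.key rank ≠ m.req.key rank) :
    IsLog rank sent (Insert.insert k D) (LogEntry.insert rank m.req l) := by
  refine ⟨LogEntry.pairwise_insert h.sorted hne, h.isSome_insert hm, fun e => ?_⟩
  rw [h.mem_iff_insert hm]
  exact List.mem_orderedInsert _

end IsLog

/-- What holds in every reachable configuration of the replay algorithm: each log consists of the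
requests known to its site; each request was generated on the copy given by its causal predecessors,
with the next clock; and site and clock together identify a request. -/
structure ReplayInv (X : CollabObject O S) (rank : O → ℕ) (c : (replay X rank).Config) : Prop where
  site : ∀ i, LogEnv.site (c.env i) = i
  log : ∀ i, IsLog rank c.sent (c.done i) (LogEnv.log (c.env i))
  req : ∀ k m, c.sent k = some m → ∃ l past, IsLog rank c.sent m.deps l ∧
    m.req = (⟨LogEntry.maxClock l + 1, m.origin, m.op⟩ : LogEntry O) ∧
    X.enabled m.origin past (X.replay l) m.op
  own : ∀ k m, c.sent k = some m → k ∈ c.done m.origin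
  notMem_deps : ∀ k m, c.sent k = some m → k ∉ m.deps
  inj : ∀ k m k' m', c.sent k = some m → c.sent k' = some m' →
    LogEntry.clock m.req = LogEntry.clock m'.req → m.origin = m'.origin → k = k'

namespace ReplayInv

variable {c : (replay X rank).Config}

theorem op_eq (h : ReplayInv X rank c) {k m} (hm : c.sent k = some m) :
    LogEntry.op m.req = m.op ∧ LogEntry.site m.req = m.origin := by
  obtain ⟨l, past, -, e, -⟩ := h.req k m hm
  rw [e]; exact ⟨rfl, rfl⟩

theorem key_ne (h : ReplayInv X rank c) {k m} (hm : c.sent k = some m) {D l}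
    (hl : IsLog rank c.sent D l) (hk : k ∉ D) :
    ∀ a ∈ l, a.key rank ≠ LogEntry.key rank m.req := by
  intro a ha e
  obtain ⟨k', hk', m', hm', rfl⟩ := (hl.mem_iff a).1 ha
  obtain ⟨e₁, e₂⟩ := LogEntry.clock_site_eq_of_key_eq e
  rw [(h.op_eq hm).2, (h.op_eq hm').2] at e₂
  exact hk (h.inj k' m' k m hm' hm e₁ e₂ ▸ hk')

theorem initial : ReplayInv X rank (Config.initial _) where
  site _ := rfl
  log i := ⟨List.Pairwise.nil, by simp [Config.initial],
    by simp [Config.initial, replay]⟩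
  req := by simp [Config.initial]
  own := by simp [Config.initial]
  notMem_deps := by simp [Config.initial]
  inj := by simp [Config.initial]

theorem request_eq (c : (replay X rank).Config) (i : Site) (op : O) :
    (replay X rank).request op ((replay X rank).localStep op (c.env i)) =
      (⟨LogEntry.maxClock (LogEnv.log (c.env i)) + 1, LogEnv.site (c.env i), op⟩ :
        LogEntry O) := by
  simp [replay, LogEntry.maxClock_append_singleton]

theorem generate (h : ReplayInv X rank c) {i : Site} {op : O} {k : ℕ} (fresh : c.sent k = none)
    (en : X.enabled i (c.past i) ((replay X rank).state (c.env i)) op) :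
    ReplayInv X rank (c.generate i op k) := by
  have ne : ∀ {k' m}, c.sent k' = some m → k' ≠ k := fun hm e => by simp [e, fresh] at hm
  have hreq := request_eq c i op
  rw [h.site i] at hreq
  have hk : (c.generate i op k).sent k = some ⟨i, op,
      (⟨LogEntry.maxClock (LogEnv.log (c.env i)) + 1, i, op⟩ : LogEntry O), c.done i⟩ := by
    simp only [Config.generate, Function.update_self, hreq]
  have hold : ∀ {k'}, k' ≠ k → (c.generate i op k).sent k' = c.sent k' := fun hne =>
    Function.update_of_ne hne _ _
  have hupd : ∀ {D l}, IsLog rank c.sent D l → IsLog rank (c.generate i op k).sent D l :=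
    fun hl => hl.update fresh _
  -- the new clock exceeds those of all requests of the same site
  have hclock : ∀ k' m, c.sent k' = some m → m.origin = i →
      LogEntry.clock m.req < LogEntry.maxClock (LogEnv.log (c.env i)) + 1 := fun k' m hm ho =>
    Nat.lt_succ_of_le (LogEntry.clock_le_maxClock
      (((h.log i).mem_iff _).2 ⟨k', ho ▸ h.own k' m hm, m, hm, rfl⟩))
  refine ⟨fun j => ?_, fun j => ?_, fun k' m hm => ?_, fun k' m hm => ?_, fun k' m hm => ?_,
    fun k₁ m₁ k₂ m₂ hm₁ hm₂ hc ho => ?_⟩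
  · by_cases hj : j = i
    · subst hj; simpa [Config.generate, replay] using h.site j
    · simpa [Config.generate, hj] using h.site j
  · by_cases hj : j = i
    · subst hj
      have := (hupd (h.log j)).append hk fun a ha =>
        LogEntry.key_lt_of_clock_lt rank (Nat.lt_succ_of_le (LogEntry.clock_le_maxClock ha))
      have e : LogEnv.site (c.env j) = j := h.site j
      simpa [Config.generate, replay, e] using this
    · simpa [Config.generate, hj] using hupd (h.log j)
  · by_cases hkk : k' = k
    · subst hkk
      obtain rfl := Option.some.inj (hk.symm.trans hm)
      exact ⟨_, _, hupd (h.log i), rfl, en⟩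
    · rw [hold hkk] at hm
      obtain ⟨l, past, h₁, h₂, h₃⟩ := h.req k' m hm
      exact ⟨l, past, hupd h₁, h₂, h₃⟩
  · by_cases hkk : k' = k
    · subst hkk
      obtain rfl := Option.some.inj (hk.symm.trans hm)
      simp [Config.generate]
    · rw [hold hkk] at hm
      have := h.own k' m hm
      by_cases hj : m.origin = i
      · rw [hj] at this ⊢; simp [Config.generate, this]
      · simpa [Config.generate, hj] using this
  · by_cases hkk : k' = k
    · subst hkk
      obtain rfl := Option.some.inj (hk.symm.trans hm)
      exact fun hmem => (h.log i).isSome k' hmem fresh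
    · rw [hold hkk] at hm
      exact h.notMem_deps k' m hm
  · by_cases h₁ : k₁ = k <;> by_cases h₂ : k₂ = k
    · rw [h₁, h₂]
    · subst h₁
      obtain rfl := Option.some.inj (hk.symm.trans hm₁)
      rw [hold h₂] at hm₂
      exact absurd hc (hclock k₂ m₂ hm₂ ho.symm).ne'
    · subst h₂
      obtain rfl := Option.some.inj (hk.symm.trans hm₂)
      rw [hold h₁] at hm₁
      exact absurd hc (hclock k₁ m₁ hm₁ ho).ne
    · rw [hold h₁] at hm₁
      rw [hold h₂] at hm₂
      exact h.inj _ _ _ _ hm₁ hm₂ hc ho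

theorem receive (h : ReplayInv X rank c) {j : Site} {k : ℕ} {m} (hm : c.sent k = some m)
    (new : k ∉ c.done j) : ReplayInv X rank (c.receive j k m) := by
  refine ⟨fun i => ?_, fun i => ?_, h.req, fun k' m' hm' => ?_, h.notMem_deps, h.inj⟩
  · by_cases hj : i = j
    · subst hj; simpa [Config.receive, replay] using h.site i
    · simpa [Config.receive, hj] using h.site i
  · by_cases hj : i = j
    · subst hj
      have := (h.log i).insert hm (h.key_ne hm (h.log i) new)
      simpa [Config.receive, replay] using this
    · simpa [Config.receive, hj] using h.log i
  · have := h.own k' m' hm'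
    by_cases hj : m'.origin = j
    · rw [hj] at this ⊢; simp [Config.receive, this]
    · simpa [Config.receive, hj] using this

theorem of_reachable (h : Reachable X (replay X rank) c) : ReplayInv X rank c := by
  induction h with
  | refl => exact initial
  | tail _ hs ih =>
    cases hs with
    | generate i op k fresh en => exact ih.generate fresh en
    | receive j k m hm new _ => exact ih.receive hm new

theorem mem_log_iff (h : ReplayInv X rank c) {D l} (hl : IsLog rank c.sent D l) {k m}
    (hm : c.sent k = some m) : (m.req : LogEntry O) ∈ l ↔ k ∈ D := by
  refine ⟨fun hmem => ?_, fun hk => (hl.mem_iff _).2 ⟨k, hk, m, hm, rfl⟩⟩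
  by_contra hk
  exact h.key_ne hm hl hk _ hmem rfl

/-- A request follows in the execution order all requests that causally precede it. -/
theorem key_lt_of_mem_deps (h : ReplayInv X rank c) {k m k' m'} (hm : c.sent k = some m)
    (hm' : c.sent k' = some m') (hk : k ∈ m'.deps) :
    LogEntry.key rank m.req < LogEntry.key rank m'.req := by
  obtain ⟨l, past, hl, e, -⟩ := h.req k' m' hm'
  refine LogEntry.key_lt_of_clock_lt rank ?_
  rw [e]
  exact Nat.lt_succ_of_le (LogEntry.clock_le_maxClock ((hl.mem_iff _).2 ⟨k, hk, m, hm, rfl⟩))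

end ReplayInv

theorem replay_convergent (X : CollabObject O S) (rank : O → ℕ) :
    (replay X rank).Convergent X where
  start_eq _ := rfl
  local_eq _ _ _ _ _ := X.replay_append_singleton _ _
  agree c hc i j hi hj := by
    have h := ReplayInv.of_reachable hc
    have hdone : c.done i = c.done j := Set.ext fun k =>
      ⟨fun hk => hj k ((h.log i).isSome k hk), fun hk => hi k ((h.log j).isSome k hk)⟩
    have : LogEnv.log (c.env i) = LogEnv.log (c.env j) :=
      (h.log i).unique (hdone ▸ h.log j)
    exact congrArg X.replay this

theorem replay_losesNoOperation (X : CollabObject O S) (rank : O → ℕ) :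
    (replay X rank).LosesNoOperation X := by
  classical
  intro c hc i
  have h := ReplayInv.of_reachable hc
  have hl := h.log i
  have hex : ∀ e : LogEntry O, ∃ k, e ∈ LogEnv.log (c.env i) →
      k ∈ c.done i ∧ ∃ m, c.sent k = some m ∧ m.req = e := fun e => by
    by_cases he : e ∈ LogEnv.log (c.env i)
    · obtain ⟨k, hk⟩ := (hl.mem_iff e).1 he
      exact ⟨k, fun _ => hk⟩
    · exact ⟨0, fun h => absurd h he⟩
  choose name hname using hex
  refine ⟨(LogEnv.log (c.env i)).map name, ?_, fun k => ?_, ?_, ?_⟩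
  · refine List.Pairwise.map _ (R := fun a b => a ∈ LogEnv.log (c.env i) ∧
      b ∈ LogEnv.log (c.env i) ∧ a.key rank < b.key rank) ?_ ?_
    · rintro a b ⟨ha, hb, hab⟩ e
      obtain ⟨-, m, hm, rfl⟩ := hname a ha
      obtain ⟨-, m', hm', rfl⟩ := hname b hb
      rw [e, hm'] at hm
      obtain rfl := Option.some.inj hm
      exact lt_irrefl _ hab
    · exact List.Pairwise.and_mem.1 hl.sorted
  · rw [List.mem_map]
    constructor
    · rintro ⟨e, he, rfl⟩
      exact (hname e he).1
    · intro hk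
      obtain ⟨m, hm⟩ := Option.ne_none_iff_exists'.1 (hl.isSome k hk)
      have he : (m.req : LogEntry O) ∈ LogEnv.log (c.env i) := (h.mem_log_iff hl hm).2 hk
      obtain ⟨-, m', hm', e⟩ := hname _ he
      refine ⟨_, he, h.inj _ _ _ _ hm' hm (by rw [e]) ?_⟩
      rw [← (h.op_eq hm').2, ← (h.op_eq hm).2, e]
  · refine List.Pairwise.map _ (R := fun a b => a ∈ LogEnv.log (c.env i) ∧
      b ∈ LogEnv.log (c.env i) ∧ a.key rank < b.key rank) ?_ ?_
    · rintro a b ⟨ha, hb, hab⟩ ⟨m, hm, hdep⟩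
      obtain ⟨-, m', hm', rfl⟩ := hname a ha
      obtain ⟨-, m'', hm'', rfl⟩ := hname b hb
      obtain rfl := Option.some.inj (hm.symm.trans hm')
      exact lt_asymm hab (h.key_lt_of_mem_deps hm'' hm hdep)
    · exact List.Pairwise.and_mem.1 hl.sorted
  · change X.run X.start _ = _
    congr 1
    rw [List.filterMap_map, ← List.filterMap_eq_map]
    refine List.filterMap_congr fun e he => ?_
    obtain ⟨-, m, hm, e'⟩ := hname e he
    have ho := (h.op_eq hm).1
    rw [e'] at ho
    simp [hm, ho]

/-- Two requests with the same causal predecessors bear the same clock, just above the clocks of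
these predecessors. Hence a site that has executed exactly the predecessors and one of the two
requests integrates the other by executing both, in the order of their ranks and sites, on the
common copy on which they were generated. -/
theorem ReplayInv.remoteStep_eq {c : (replay X rank).Config} (h : ReplayInv X rank c)
    {j k m k' m'} (hm : c.sent k = some m) (hm' : c.sent k' = some m')
    (hdeps : m.deps = m'.deps) (hdone : c.done j = Insert.insert k' m'.deps)
    (hk : k ∉ c.done j) :
    m.origin ≠ m'.origin ∧ ∃ l past past', IsLog rank c.sent m.deps l ∧
      X.enabled m.origin past (X.replay l) m.op ∧ X.enabled m'.origin past' (X.replay l) m'.op ∧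
      (replay X rank).state (c.env j) = X.exec (X.replay l) m'.op ∧
      (((rank m.op < rank m'.op ∨ rank m.op = rank m'.op ∧ m'.origin < m.origin) ∧
        (replay X rank).state ((replay X rank).remoteStep m.req (c.env j)) =
          X.exec (X.exec (X.replay l) m.op) m'.op) ∨
      ((rank m'.op < rank m.op ∨ rank m'.op = rank m.op ∧ m.origin < m'.origin) ∧
        (replay X rank).state ((replay X rank).remoteStep m.req (c.env j)) =
          X.exec (X.exec (X.replay l) m'.op) m.op)) := by
  obtain ⟨l, past, hl, e, en⟩ := h.req k m hm
  obtain ⟨l', past', hl', e', en'⟩ := h.req k' m' hm'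
  obtain rfl := hl.unique (hdeps ▸ hl')
  have hclock : LogEntry.clock m.req = LogEntry.clock m'.req := by rw [e, e']
  have hkk : k ≠ k' := fun hkk => hk (by simp [hdone, hkk])
  have hne : m.origin ≠ m'.origin := fun ho => hkk (h.inj _ _ _ _ hm hm' hclock ho)
  have hop := h.op_eq hm
  have hop' := h.op_eq hm'
  have hkdeps : k ∉ m.deps := h.notMem_deps k m hm
  have hkdeps' : k' ∉ m'.deps := h.notMem_deps k' m' hm'
  have below : ∀ a ∈ l, a.clock < LogEntry.clock m.req := fun a ha => by
    rw [e]; exact Nat.lt_succ_of_le (LogEntry.clock_le_maxClock ha)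
  have below₁ : ∀ a ∈ l, a.key rank < LogEntry.key rank m.req := fun a ha =>
    LogEntry.key_lt_of_clock_lt rank (below a ha)
  have below₂ : ∀ a ∈ l, a.key rank < LogEntry.key rank m'.req := fun a ha =>
    LogEntry.key_lt_of_clock_lt rank (hclock ▸ below a ha)
  have hlog := hl'.append hm' below₂
  rw [← hdone] at hlog
  replace hlog := (h.log j).unique hlog
  have hins := (h.log j).insert hm (h.key_ne hm (h.log j) hk)
  refine ⟨hne, l, past, past', hl, en, en', ?_, ?_⟩
  · change X.replay (LogEnv.log (c.env j)) = _
    rw [hlog, X.replay_append_singleton, hop'.1]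
  · have hkey := LogEntry.key_lt_iff_of_clock_eq (rank := rank) hclock
    have hkey' := LogEntry.key_lt_iff_of_clock_eq (rank := rank) hclock.symm
    rw [hop.1, hop.2, hop'.1, hop'.2] at hkey hkey'
    rcases lt_trichotomy (LogEntry.key rank m.req) (LogEntry.key rank m'.req) with hlt | heq | hlt
    · refine .inl ⟨hkey.1 hlt, ?_⟩
      have hins' := (hl.append hm below₁).append hm' (by
        intro a ha
        rcases List.mem_append.1 ha with ha | ha
        · exact below₂ a ha
        · rw [List.mem_singleton.1 ha]; exact hlt)
      rw [Set.insert_comm, hdeps, ← hdone] at hins'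
      change X.replay (LogEntry.insert rank m.req (LogEnv.log (c.env j))) = _
      rw [hins.unique hins', X.replay_append_singleton, X.replay_append_singleton, hop.1, hop'.1]
    · exact absurd (LogEntry.clock_site_eq_of_key_eq heq).2 (by rwa [hop.2, hop'.2])
    · refine .inr ⟨hkey'.1 hlt, ?_⟩
      have hins' := (hl'.append hm' below₂).append hm (by
        intro a ha
        rcases List.mem_append.1 ha with ha | ha
        · exact below₁ a ha
        · rw [List.mem_singleton.1 ha]; exact hlt)
      rw [← hdone] at hins'
      change X.replay (LogEntry.insert rank m.req (LogEnv.log (c.env j))) = _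
      rw [hins.unique hins', X.replay_append_singleton, X.replay_append_singleton, hop.1, hop'.1]

end EditingAlgorithm

/-! ### Paths in trees -/

namespace Forest

variable {Lab : Type u}

/-- `Row t l π`: the tree `t` has an edge labelled `l` such that the identifiers from the root to
this edge, itself included, form the list `π`. -/
def Row : Forest Lab → Option Lab → List Ident → Prop
  | nil, _, _ => False
  | cons l i s r, l', π => (l' = l ∧ π = [i]) ∨ (∃ π', π = i :: π' ∧ Row s l' π') ∨ Row r l' π

@[simp] theorem row_nil (l : Option Lab) (π : List Ident) : ¬ Row nil l π := id

@[simp] theorem row_cons {l l' : Option Lab} {i : Ident} {s r : Forest Lab} {π : List Ident} :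
    Row (cons l i s r) l' π ↔
      (l' = l ∧ π = [i]) ∨ (∃ π', π = i :: π' ∧ Row s l' π') ∨ Row r l' π := Iff.rfl

theorem row_congr {s t : Forest Lab} (h : Equiv s t) (l : Option Lab) (π : List Ident) :
    Row s l π ↔ Row t l π := by
  induction h generalizing π with
  | refl => rfl
  | symm _ ih => exact (ih π).symm
  | trans _ _ ih₁ ih₂ => exact (ih₁ π).trans (ih₂ π)
  | cons l i _ _ ih₁ ih₂ => simp only [row_cons, ih₁, ih₂]
  | swap => simp only [row_cons]; grind

theorem Row.ne_nil {t : Forest Lab} {l : Option Lab} {π : List Ident} (h : Row t l π) :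
    π ≠ [] := by
  induction t generalizing π with
  | nil => exact h.elim
  | cons l' i s r _ ih₂ =>
    rcases h with ⟨-, rfl⟩ | ⟨π', rfl, -⟩ | h
    · simp
    · simp
    · exact ih₂ h

theorem Row.mem_ids {t : Forest Lab} {l : Option Lab} {π : List Ident} (h : Row t l π) :
    ∀ x ∈ π, x ∈ ids t := by
  induction t generalizing π with
  | nil => exact h.elim
  | cons l' i s r ih₁ ih₂ =>
    intro x hx
    simp only [ids, Multiset.mem_cons, Multiset.mem_add]
    rcases h with ⟨-, rfl⟩ | ⟨π', rfl, h⟩ | h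
    · simp at hx; exact .inl hx
    · rcases List.mem_cons.1 hx with rfl | hx
      · exact .inl rfl
      · exact .inr (.inl (ih₁ h x hx))
    · exact .inr (.inr (ih₂ h x hx))

theorem exists_row_of_mem_ids {t : Forest Lab} {x : Ident} (h : x ∈ ids t) :
    ∃ l π, Row t l (π ++ [x]) := by
  induction t with
  | nil => simp [ids] at h
  | cons l' i s r ih₁ ih₂ =>
    simp only [ids, Multiset.mem_cons, Multiset.mem_add] at h
    rcases h with rfl | h | h
    · exact ⟨l', [], .inl ⟨rfl, rfl⟩⟩
    · obtain ⟨l, π, h⟩ := ih₁ h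
      exact ⟨l, i :: π, .inr (.inl ⟨_, rfl, h⟩)⟩
    · obtain ⟨l, π, h⟩ := ih₂ h
      exact ⟨l, π, .inr (.inr h)⟩

/-- Every nonempty initial segment of a path is a path. -/
theorem Row.of_append {t : Forest Lab} {l : Option Lab} {π π' : List Ident} (h : Row t l (π ++ π'))
    (hπ : π ≠ []) : ∃ l', Row t l' π := by
  induction t generalizing π with
  | nil => exact h.elim
  | cons l' i s r ih₁ ih₂ =>
    rcases h with ⟨-, h⟩ | ⟨π'', e, h⟩ | h
    · have : π = [i] := by
        cases π with
        | nil => exact absurd rfl hπ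
        | cons a π => simp at h; simp [h]
      exact ⟨l', .inl ⟨rfl, this⟩⟩
    · cases π with
      | nil => exact absurd rfl hπ
      | cons a π =>
        simp only [List.cons_append, List.cons.injEq] at e
        obtain ⟨rfl, rfl⟩ := e
        by_cases hn : π = []
        · exact ⟨l', .inl ⟨rfl, by rw [hn]⟩⟩
        · obtain ⟨l'', h⟩ := ih₁ h hn
          exact ⟨l'', .inr (.inl ⟨π, rfl, h⟩)⟩
    · obtain ⟨l'', h⟩ := ih₂ h hπ
      exact ⟨l'', .inr (.inr h)⟩

theorem Row.nodup {t : Forest Lab} (ht : (ids t).Nodup) {l : Option Lab} {π : List Ident}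
    (h : Row t l π) : π.Nodup := by
  induction t generalizing π with
  | nil => exact h.elim
  | cons l' i s r ih₁ ih₂ =>
    simp only [ids, Multiset.nodup_cons, Multiset.nodup_add, Multiset.mem_add, not_or] at ht
    rcases h with ⟨-, rfl⟩ | ⟨π', rfl, h⟩ | h
    · simp
    · exact List.nodup_cons.2 ⟨fun hi => ht.1.1 (h.mem_ids i hi), ih₁ ht.2.1 h⟩
    · exact ih₂ ht.2.2.1 h

/-- If every identifier occurs once, an identifier determines its path and its label. -/
theorem Row.unique {t : Forest Lab} (ht : (ids t).Nodup) {l l' : Option Lab} {π π' : List Ident}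
    {x : Ident} (h : Row t l (π ++ [x])) (h' : Row t l' (π' ++ [x])) : l = l' ∧ π = π' := by
  induction t generalizing π π' with
  | nil => exact h.elim
  | cons l₀ i s r ih₁ ih₂ =>
    simp only [ids, Multiset.nodup_cons, Multiset.nodup_add, Multiset.mem_add, not_or,
      Multiset.disjoint_left] at ht
    obtain ⟨⟨his, hir⟩, hs, hr, hd⟩ := ht
    -- the three positions of `x` exclude each other
    have key : ∀ {l : Option Lab} {π : List Ident}, Row (cons l₀ i s r) l (π ++ [x]) →
        (x = i ∧ l = l₀ ∧ π = []) ∨ (x ∈ ids s ∧ ∃ ρ, π = i :: ρ ∧ Row s l (ρ ++ [x])) ∨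
        (x ∈ ids r ∧ Row r l (π ++ [x])) := by
      intro l π h
      rcases h with ⟨hl, h⟩ | ⟨π', e, h⟩ | h
      · have := List.append_eq_singleton_iff.1 h
        simp at this
        exact .inl ⟨this.2, hl, this.1⟩
      · cases π with
        | nil =>
          simp only [List.nil_append, List.cons.injEq] at e
          exact absurd e.2.symm h.ne_nil
        | cons a π =>
          simp only [List.cons_append, List.cons.injEq] at e
          obtain ⟨rfl, rfl⟩ := e
          exact .inr (.inl ⟨h.mem_ids x (by simp), π, rfl, h⟩)
      · exact .inr (.inr ⟨h.mem_ids x (by simp), h⟩)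
    rcases key h with ⟨e, hl, hπ⟩ | ⟨hx, ρ, rfl, h₁⟩ | ⟨hx, h₁⟩ <;>
    rcases key h' with ⟨e', hl', hπ'⟩ | ⟨hx', ρ', rfl, h₁'⟩ | ⟨hx', h₁'⟩
    · exact ⟨hl.trans hl'.symm, hπ.trans hπ'.symm⟩
    · exact absurd (e ▸ hx') his
    · exact absurd (e ▸ hx') hir
    · exact absurd (e' ▸ hx) his
    · obtain ⟨rfl, rfl⟩ := ih₁ hs h₁ h₁'
      exact ⟨rfl, rfl⟩
    · exact absurd hx' (hd hx)
    · exact absurd (e' ▸ hx) hir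
    · exact absurd hx (hd hx')
    · exact ih₂ hr h₁ h₁'

theorem Row.exists_equiv_cons {t : Forest Lab} {l : Option Lab} {i : Ident} (h : Row t l [i]) :
    ∃ s r, Equiv t (cons l i s r) := by
  induction t with
  | nil => exact h.elim
  | cons l' i' s r _ ih₂ =>
    rcases h with ⟨rfl, e⟩ | ⟨π', e, h⟩ | h
    · obtain rfl := List.singleton_inj.1 e
      exact ⟨s, r, .refl _⟩
    · simp only [List.cons.injEq] at e
      exact absurd e.2.symm h.ne_nil
    · obtain ⟨s', r', h⟩ := ih₂ h
      exact ⟨s', cons l' i' s r', (Equiv.cons l' i' (.refl s) h).trans (.swap ..)⟩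

/-- A tree in which every identifier occurs once is determined by its paths and their labels. -/
theorem equiv_of_row_iff {t t' : Forest Lab} (ht : (ids t).Nodup) (ht' : (ids t').Nodup)
    (h : ∀ l π, Row t l π ↔ Row t' l π) : Equiv t t' := by
  induction t generalizing t' with
  | nil =>
    cases t' with
    | nil => exact .refl _
    | cons l i s r => exact absurd ((h l [i]).2 (.inl ⟨rfl, rfl⟩)) (row_nil _ _)
  | cons l i s r ih₁ ih₂ =>
    obtain ⟨s', r', e⟩ := Row.exists_equiv_cons ((h l [i]).1 (.inl ⟨rfl, rfl⟩))
    rw [ids_congr e] at ht'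
    simp only [row_congr e] at h
    refine .trans (.cons l i ?_ ?_) e.symm
    all_goals
      simp only [ids, Multiset.nodup_cons, Multiset.nodup_add, Multiset.mem_add, not_or] at ht ht'
    · refine ih₁ ht.2.1 ht'.2.1 fun l' π => ?_
      have := h l' (i :: π)
      have hn : ¬ Row r l' (i :: π) := fun hr => ht.1.2 (hr.mem_ids i (by simp))
      have hn' : ¬ Row r' l' (i :: π) := fun hr => ht'.1.2 (hr.mem_ids i (by simp))
      by_cases hπ : π = []
      · subst hπ
        exact ⟨fun h => absurd rfl h.ne_nil, fun h => absurd rfl h.ne_nil⟩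
      · simpa [hn, hn', hπ] using this
    · refine ih₂ ht.2.2.1 ht'.2.2.1 fun l' π => ?_
      have := h l' π
      by_cases hi : i ∈ π
      · exact ⟨fun hr => absurd (hr.mem_ids i hi) ht.1.2,
          fun hr => absurd (hr.mem_ids i hi) ht'.1.2⟩
      · have h₁ : π ≠ [i] := by rintro rfl; simp at hi
        have h₂ : ∀ π', π ≠ i :: π' := by rintro π' rfl; simp at hi
        simpa [h₁, h₂] using this

theorem row_union {s t : Forest Lab} {l : Option Lab} {π : List Ident} :
    Row (union s t) l π ↔ Row s l π ∨ Row t l π := by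
  induction s with
  | nil => simp [union]
  | cons l' i s r _ ih => simp [union, ih, or_assoc]

theorem row_erase {a : Ident} {t : Forest Lab} {l : Option Lab} {π : List Ident} :
    Row (erase a t) l π ↔ Row t l π ∧ a ∉ π := by
  induction t generalizing π with
  | nil => simp [erase]
  | cons l' i s r ih₁ ih₂ =>
    by_cases h : i = a
    · subst h
      simp only [erase, if_true, ih₂, row_cons]
      constructor
      · rintro ⟨h, h'⟩; exact ⟨.inr (.inr h), h'⟩
      · rintro ⟨⟨-, rfl⟩ | ⟨π', rfl, -⟩ | h, h'⟩
        · simp at h'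
        · simp at h'
        · exact ⟨h, h'⟩
    · simp only [erase, h, if_false, ih₂, ih₁, row_cons]
      constructor
      · rintro (⟨rfl, rfl⟩ | ⟨π', rfl, h₁, h₂⟩ | ⟨h₁, h₂⟩)
        · exact ⟨.inl ⟨rfl, rfl⟩, by simpa using Ne.symm h⟩
        · exact ⟨.inr (.inl ⟨π', rfl, h₁⟩), by simp [Ne.symm h, h₂]⟩
        · exact ⟨.inr (.inr h₁), h₂⟩
      · rintro ⟨⟨rfl, rfl⟩ | ⟨π', rfl, h₁⟩ | h₁, h₂⟩
        · exact .inl ⟨rfl, rfl⟩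
        · exact .inr (.inl ⟨π', rfl, h₁, fun h => h₂ (by simp [h])⟩)
        · exact .inr (.inr ⟨h₁, h₂⟩)

theorem row_projEdge {a : Ident} {t : Forest Lab} {l : Option Lab} {π : List Ident} :
    Row (projEdge a t) l π ↔ ∃ u v, a ∉ u ∧ π = a :: v ∧ Row t l (u ++ π) := by
  induction t generalizing π with
  | nil => simp [projEdge]
  | cons l' i s r ih₁ ih₂ =>
    by_cases h : i = a
    · subst h
      simp only [projEdge, if_true, ih₂, row_cons]
      constructor
      · rintro (⟨rfl, rfl⟩ | ⟨π', rfl, h₁⟩ | ⟨u, v, h₁, h₂, h₃⟩)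
        · exact ⟨[], [], by simp, rfl, .inl ⟨rfl, rfl⟩⟩
        · exact ⟨[], π', by simp, rfl, .inr (.inl ⟨π', rfl, h₁⟩)⟩
        · exact ⟨u, v, h₁, h₂, .inr (.inr h₃)⟩
      · rintro ⟨u, v, h₁, rfl, h₂⟩
        cases u with
        | nil =>
          rcases h₂ with ⟨rfl, h₂⟩ | ⟨π', h₂, h₃⟩ | h₂
          · exact .inl ⟨rfl, h₂⟩
          · exact .inr (.inl ⟨π', h₂, h₃⟩)
          · exact .inr (.inr ⟨[], v, by simp, rfl, h₂⟩)
        | cons b u =>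
          have hb : b ≠ i := by rintro rfl; simp at h₁
          rcases h₂ with ⟨rfl, h₂⟩ | ⟨π', h₂, h₃⟩ | h₂
          · simp [hb] at h₂
          · simp [hb] at h₂
          · exact .inr (.inr ⟨b :: u, v, h₁, rfl, h₂⟩)
    · simp only [projEdge, h, if_false, ih₂, ih₁, row_cons, row_union]
      constructor
      · rintro (⟨u, v, h₁, rfl, h₂⟩ | ⟨u, v, h₁, rfl, h₂⟩)
        · exact ⟨i :: u, v, by simp [Ne.symm h, h₁], rfl, .inr (.inl ⟨_, rfl, h₂⟩)⟩
        · exact ⟨u, v, h₁, rfl, .inr (.inr h₂)⟩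
      · rintro ⟨u, v, h₁, rfl, h₂⟩
        rcases h₂ with ⟨rfl, h₂⟩ | ⟨π', h₂, h₃⟩ | h₂
        · have := List.append_eq_singleton_iff.1 h₂
          simp [Ne.symm h] at this
        · cases u with
          | nil => simp [Ne.symm h] at h₂
          | cons b u =>
            simp only [List.cons_append, List.cons.injEq] at h₂
            obtain ⟨rfl, rfl⟩ := h₂
            exact .inl ⟨u, v, fun h => h₁ (by simp [h]), rfl, h₃⟩
        · exact .inr ⟨u, v, h₁, rfl, h₂⟩

theorem row_proj {a : Ident} {t : Forest Lab} {l : Option Lab} {π : List Ident} :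
    Row (proj a t) l π ↔ π ≠ [] ∧ Row (projEdge a t) l (a :: π) := by
  induction t generalizing π with
  | nil => simp [proj, projEdge]
  | cons l' i s r ih₁ ih₂ =>
    by_cases h : i = a
    · subst h
      simp only [proj, projEdge, if_true, ih₂, row_cons, row_union]
      constructor
      · rintro (h | ⟨h, h'⟩)
        · exact ⟨h.ne_nil, .inr (.inl ⟨π, rfl, h⟩)⟩
        · exact ⟨h, .inr (.inr h')⟩
      · rintro ⟨hπ, ⟨-, h⟩ | ⟨π', h, h'⟩ | h⟩
        · simp [hπ] at h
        · obtain rfl : π = π' := by simpa using h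
          exact .inl h'
        · exact .inr ⟨hπ, h⟩
    · simp only [proj, projEdge, h, if_false, ih₂, ih₁, row_union, and_or_left]

theorem row_addTree {p : Ident} {a t : Forest Lab} {l : Option Lab} {π : List Ident} :
    Row (addTree p a t) l π ↔
      Row t l π ∨ ∃ u v l', p ∉ u ∧ Row t l' (u ++ [p]) ∧ Row a l v ∧ π = u ++ p :: v := by
  induction t generalizing π with
  | nil => simp [addTree]
  | cons l₀ i s r ih₁ ih₂ =>
    by_cases h : i = p
    · subst h
      simp only [addTree, if_true, ih₂, row_cons, row_union]
      constructor
      · rintro (⟨rfl, rfl⟩ | ⟨π', rfl, h₁ | h₁⟩ | h₁ | ⟨u, v, l', h₁, h₂, h₃, rfl⟩)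
        · exact .inl (.inl ⟨rfl, rfl⟩)
        · exact .inl (.inr (.inl ⟨_, rfl, h₁⟩))
        · exact .inr ⟨[], π', l₀, by simp, .inl ⟨rfl, rfl⟩, h₁, rfl⟩
        · exact .inl (.inr (.inr h₁))
        · exact .inr ⟨u, v, l', h₁, .inr (.inr h₂), h₃, rfl⟩
      · rintro ((⟨rfl, rfl⟩ | ⟨π', rfl, h₁⟩ | h₁) | ⟨u, v, l', h₁, h₂, h₃, rfl⟩)
        · exact .inl ⟨rfl, rfl⟩
        · exact .inr (.inl ⟨_, rfl, .inl h₁⟩)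
        · exact .inr (.inr (.inl h₁))
        · cases u with
          | nil => exact .inr (.inl ⟨v, rfl, .inr h₃⟩)
          | cons b u =>
            have hb : b ≠ i := by rintro rfl; simp at h₁
            rcases h₂ with ⟨rfl, h₂⟩ | ⟨π', h₂, -⟩ | h₂
            · simp [hb] at h₂
            · simp [hb] at h₂
            · exact .inr (.inr (.inr ⟨b :: u, v, l', h₁, h₂, h₃, rfl⟩))
    · simp only [addTree, h, if_false, ih₁, ih₂, row_cons]
      constructor
      · rintro (⟨rfl, rfl⟩ | ⟨π', rfl, h₁ | ⟨u, v, l', h₁, h₂, h₃, rfl⟩⟩ | h₁ |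
          ⟨u, v, l', h₁, h₂, h₃, rfl⟩)
        · exact .inl (.inl ⟨rfl, rfl⟩)
        · exact .inl (.inr (.inl ⟨_, rfl, h₁⟩))
        · exact .inr ⟨i :: u, v, l', by simp [Ne.symm h, h₁], .inr (.inl ⟨_, rfl, h₂⟩), h₃, rfl⟩
        · exact .inl (.inr (.inr h₁))
        · exact .inr ⟨u, v, l', h₁, .inr (.inr h₂), h₃, rfl⟩
      · rintro ((⟨rfl, rfl⟩ | ⟨π', rfl, h₁⟩ | h₁) | ⟨u, v, l', h₁, h₂, h₃, rfl⟩)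
        · exact .inl ⟨rfl, rfl⟩
        · exact .inr (.inl ⟨_, rfl, .inl h₁⟩)
        · exact .inr (.inr (.inl h₁))
        · rcases h₂ with ⟨rfl, h₂⟩ | ⟨π', h₂, h₄⟩ | h₂
          · have := List.append_eq_singleton_iff.1 h₂
            simp [Ne.symm h] at this
          · cases u with
            | nil => simp [Ne.symm h] at h₂
            | cons b u =>
              simp only [List.cons_append, List.cons.injEq] at h₂
              obtain ⟨rfl, rfl⟩ := h₂
              exact .inr (.inl ⟨u ++ p :: v, rfl, .inr
                ⟨u, v, l', fun h => h₁ (by simp [h]), h₄, h₃, rfl⟩⟩)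
          · exact .inr (.inr (.inr ⟨u, v, l', h₁, h₂, h₃, rfl⟩))

/-- Renaming changes the label exactly on the paths that end in the renamed edge. -/
theorem row_rename {a : Ident} {l₀ : Lab} {t : Forest Lab} (ht : (ids t).Nodup)
    {l : Option Lab} {π : List Ident} :
    Row (rename a l₀ t) l π ↔
      ∃ l', Row t l' π ∧ ([a] <:+ π ∧ l = some l₀ ∨ ¬ [a] <:+ π ∧ l = l') := by
  induction t generalizing π with
  | nil => simp [rename]
  | cons l₁ i s r ih₁ ih₂ =>
    simp only [ids, Multiset.nodup_cons, Multiset.nodup_add, Multiset.mem_add, not_or] at ht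
    obtain ⟨⟨his, hir⟩, hs, hr, -⟩ := ht
    have hsuf : ∀ {π : List Ident} {l : Option Lab}, Row s l π → ([a] <:+ i :: π ↔ [a] <:+ π) := by
      intro π l h
      rw [List.suffix_cons_iff]
      refine or_iff_right fun e => h.ne_nil ?_
      simpa using (List.cons.inj e).2.symm
    have hone : [a] <:+ [i] ↔ i = a := by simp [List.suffix_cons_iff, eq_comm]
    by_cases h : i = a
    · subst h
      have hns : ∀ {π : List Ident} {l : Option Lab}, Row s l π → ¬ [i] <:+ π := fun h hsu =>
        his (h.mem_ids i (hsu.subset (by simp)))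
      simp only [rename, if_true, ih₂ hr, row_cons]
      constructor
      · rintro (⟨rfl, rfl⟩ | ⟨π', rfl, h₁⟩ | ⟨l', h₁, h₂⟩)
        · exact ⟨l₁, .inl ⟨rfl, rfl⟩, by simp⟩
        · exact ⟨l, .inr (.inl ⟨_, rfl, h₁⟩), .inr ⟨by rw [hsuf h₁]; exact hns h₁, rfl⟩⟩
        · exact ⟨l', .inr (.inr h₁), h₂⟩
      · rintro ⟨l', ⟨rfl, rfl⟩ | ⟨π', rfl, h₁⟩ | h₁, h₂⟩
        · exact .inl (by simpa using h₂)
        · rw [hsuf h₁] at h₂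
          obtain rfl : l = l' := by simpa [hns h₁] using h₂
          exact .inr (.inl ⟨π', rfl, h₁⟩)
        · exact .inr (.inr ⟨l', h₁, h₂⟩)
    · simp only [rename, h, if_false, ih₁ hs, ih₂ hr, row_cons]
      constructor
      · rintro (⟨rfl, rfl⟩ | ⟨π', rfl, l', h₁, h₂⟩ | ⟨l', h₁, h₂⟩)
        · exact ⟨l, .inl ⟨rfl, rfl⟩, by simp [hone, h]⟩
        · exact ⟨l', .inr (.inl ⟨_, rfl, h₁⟩), by rwa [hsuf h₁]⟩
        · exact ⟨l', .inr (.inr h₁), h₂⟩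
      · rintro ⟨l', ⟨rfl, rfl⟩ | ⟨π', rfl, h₁⟩ | h₁, h₂⟩
        · exact .inl (by simpa [hone, h] using h₂)
        · exact .inr (.inl ⟨π', rfl, l', h₁, by rwa [hsuf h₁] at h₂⟩)
        · exact .inr (.inr ⟨l', h₁, h₂⟩)

end Forest

/-! ### Parents in well-formed trees -/

namespace UTree

variable {Lab : Type u}

/-- `Row t l π`: the list `π` of identifiers is the path from the root to an edge labelled `l`. -/
def Row (t : UTree Lab) (l : Option Lab) (π : List Ident) : Prop :=
  Quotient.lift (fun f : Forest Lab => f.Row l π)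
    (fun _ _ h => propext (Forest.row_congr h l π)) t

/-- `Edge t x l q`: the edge with identifier `x` is labelled `l` and lies directly below `q`. Edges
at the root have no parent and are not described. -/
def Edge (t : UTree Lab) (x : Ident) (l : Option Lab) (q : Ident) : Prop :=
  ∃ π, t.Row l π ∧ [q, x] <:+ π

/-- `Under t a x`: both identifiers occur in `t`, and `x` is `a` or lies below `a`. -/
def Under (t : UTree Lab) (a x : Ident) : Prop :=
  ∃ l π, t.Row l π ∧ [x] <:+ π ∧ a ∈ π

theorem singleton_suffix_append {u : List Ident} {x y : Ident} : [x] <:+ u ++ [y] ↔ x = y := by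
  rw [← List.reverse_prefix]; simp

theorem pair_suffix_append {u : List Ident} {q x p y : Ident} :
    [q, x] <:+ u ++ [p, y] ↔ q = p ∧ x = y := by
  rw [← List.reverse_prefix]; simp [and_comm]

theorem suffix_append_of_ne_nil {u v : List Ident} {x : Ident} (hv : v ≠ []) :
    [x] <:+ u ++ v ↔ [x] <:+ v :=
  ⟨fun h => List.suffix_of_suffix_length_le h (List.suffix_append u v)
    (List.length_pos_iff.2 hv), fun h => h.trans (List.suffix_append u v)⟩

theorem singleton_suffix_cons {v : List Ident} {a x : Ident} (hv : v ≠ []) :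
    [x] <:+ a :: v ↔ [x] <:+ v :=
  suffix_append_of_ne_nil (u := [a]) hv

theorem pair_suffix_append_cons {u v : List Ident} {q x a : Ident} (hv : v ≠ []) :
    [q, x] <:+ u ++ a :: v ↔ [q, x] <:+ a :: v :=
  ⟨fun h => List.suffix_of_suffix_length_le h (List.suffix_append u _)
    (by simpa using Nat.succ_le_of_lt (List.length_pos_iff.2 hv)),
    fun h => h.trans (List.suffix_append u _)⟩

theorem singleton_suffix_of_pair {π : List Ident} {q x : Ident} (h : [q, x] <:+ π) : [x] <:+ π :=
  (List.suffix_cons q [x]).trans h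

theorem Row.mem_ids {t : UTree Lab} {l : Option Lab} {π : List Ident} (h : t.Row l π) {x : Ident}
    (hx : x ∈ π) : x ∈ t.ids := by
  induction t using Quotient.inductionOn with | h t =>
  exact Forest.Row.mem_ids h x hx

theorem mem_ids_iff {t : UTree Lab} {x : Ident} : x ∈ t.ids ↔ ∃ l u, t.Row l (u ++ [x]) := by
  refine ⟨fun h => ?_, fun ⟨l, u, h⟩ => h.mem_ids (by simp)⟩
  induction t using Quotient.inductionOn with | h t =>
  exact Forest.exists_row_of_mem_ids h

theorem Under.refl {t : UTree Lab} {x : Ident} (hx : x ∈ t.ids) : t.Under x x := by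
  obtain ⟨l, u, h⟩ := mem_ids_iff.1 hx
  exact ⟨l, _, h, by simp, by simp⟩

theorem Row.nodup {t : UTree Lab} (ht : t.ids.Nodup) {l : Option Lab} {π : List Ident}
    (h : t.Row l π) : π.Nodup := by
  induction t using Quotient.inductionOn with | h t =>
  exact Forest.Row.nodup ht h

theorem Row.ne_nil {t : UTree Lab} {l : Option Lab} {π : List Ident}
    (h : t.Row l π) : π ≠ [] := by
  induction t using Quotient.inductionOn with | h t =>
  exact Forest.Row.ne_nil h

theorem Row.of_append {t : UTree Lab} {l : Option Lab} {π π' : List Ident} (h : t.Row l (π ++ π'))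
    (hπ : π ≠ []) : ∃ l', t.Row l' π := by
  induction t using Quotient.inductionOn with | h t =>
  exact Forest.Row.of_append h hπ

theorem Row.unique {t : UTree Lab} (ht : t.ids.Nodup) {l l' : Option Lab} {π π' : List Ident}
    {x : Ident} (h : t.Row l π) (h' : t.Row l' π') (hx : [x] <:+ π) (hx' : [x] <:+ π') :
    l = l' ∧ π = π' := by
  obtain ⟨u, rfl⟩ := hx
  obtain ⟨u', rfl⟩ := hx'
  induction t using Quotient.inductionOn with | h t =>
  obtain ⟨h₁, h₂⟩ := Forest.Row.unique ht h h'
  exact ⟨h₁, by rw [h₂]⟩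

theorem ext_row {t t' : UTree Lab} (ht : t.ids.Nodup) (ht' : t'.ids.Nodup)
    (h : ∀ l π, t.Row l π ↔ t'.Row l π) : t = t' := by
  induction t using Quotient.inductionOn with | h t =>
  induction t' using Quotient.inductionOn with | h t' =>
  exact Quotient.sound (Forest.equiv_of_row_iff ht ht' h)

theorem row_erase {a : Ident} {t : UTree Lab} {l : Option Lab} {π : List Ident} :
    (erase a t).Row l π ↔ t.Row l π ∧ a ∉ π := by
  induction t using Quotient.inductionOn with | h t =>
  exact Forest.row_erase

theorem row_projEdge {a : Ident} {t : UTree Lab} (ht : t.ids.Nodup) {l : Option Lab}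
    {π : List Ident} : (projEdge a t).Row l π ↔ ∃ w v, π = a :: v ∧ t.Row l (w ++ a :: v) := by
  have hn : ∀ {l π}, t.Row l π → π.Nodup := fun h => h.nodup ht
  induction t using Quotient.inductionOn with | h t =>
  refine Forest.row_projEdge.trans (exists_congr fun w => exists_congr fun v => ?_)
  constructor
  · rintro ⟨-, rfl, h⟩; exact ⟨rfl, h⟩
  · rintro ⟨rfl, h⟩
    refine ⟨fun ha => ?_, rfl, h⟩
    exact (List.nodup_append.1 (hn h)).2.2 a ha a (by simp) rfl

theorem row_proj {a : Ident} {t : UTree Lab} (ht : t.ids.Nodup) {l : Option Lab}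
    {π : List Ident} : (proj a t).Row l π ↔ π ≠ [] ∧ ∃ w, t.Row l (w ++ a :: π) := by
  have : (proj a t).Row l π ↔ π ≠ [] ∧ (projEdge a t).Row l (a :: π) := by
    induction t using Quotient.inductionOn with | h t =>
    exact Forest.row_proj
  rw [this, row_projEdge ht]
  simp

theorem row_addTree {p : Ident} {s t : UTree Lab} (ht : t.ids.Nodup) {l : Option Lab}
    {π : List Ident} : (addTree p s t).Row l π ↔
      t.Row l π ∨ ∃ u v l', t.Row l' (u ++ [p]) ∧ s.Row l v ∧ π = u ++ p :: v := by
  have hn : ∀ {l π}, t.Row l π → π.Nodup := fun h => h.nodup ht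
  induction t using Quotient.inductionOn with | h t =>
  induction s using Quotient.inductionOn with | h s =>
  refine Forest.row_addTree.trans (or_congr_right (exists_congr fun u => exists_congr fun v =>
    exists_congr fun l' => ⟨And.right, fun h => ⟨fun hp => ?_, h⟩⟩))
  exact (List.nodup_append.1 (hn h.1)).2.2 p hp p (by simp) rfl

theorem row_rename {a : Ident} {l₀ : Lab} {t : UTree Lab} (ht : t.ids.Nodup) {l : Option Lab}
    {π : List Ident} : (rename a l₀ t).Row l π ↔
      ∃ l', t.Row l' π ∧ ([a] <:+ π ∧ l = some l₀ ∨ ¬ [a] <:+ π ∧ l = l') := by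
  induction t using Quotient.inductionOn with | h t =>
  exact Forest.row_rename ht

theorem row_leaf {l₀ : Lab} {id : Ident} {l : Option Lab} {π : List Ident} :
    (leaf l₀ id).Row l π ↔ l = some l₀ ∧ π = [id] := by
  refine (Forest.row_cons (s := .nil) (r := .nil)).trans ?_
  simp

theorem nodup_erase {a : Ident} {t : UTree Lab} (ht : t.ids.Nodup) : (erase a t).ids.Nodup := by
  induction t using Quotient.inductionOn with | h t =>
  exact Multiset.nodup_of_le ((Multiset.le_add_right _ _).trans_eq (Forest.ids_erase_add a t)) ht

theorem mem_ids_projEdge {a x : Ident} {t : UTree Lab} (ht : t.ids.Nodup) :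
    x ∈ (projEdge a t).ids ↔ t.Under a x := by
  rw [mem_ids_iff]
  constructor
  · rintro ⟨l, u, h⟩
    obtain ⟨w, v, e, h⟩ := (row_projEdge ht).1 h
    exact ⟨l, w ++ a :: v, h, by rw [← e, ← List.append_assoc]; exact List.suffix_append _ _,
      by simp⟩
  · rintro ⟨l, π, h, hx, ha⟩
    obtain ⟨w, v, rfl⟩ := List.append_of_mem ha
    rw [suffix_append_of_ne_nil (by simp)] at hx
    obtain ⟨u, hu⟩ := hx
    exact ⟨l, u, (row_projEdge ht).2 ⟨w, v, hu, h⟩⟩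

namespace WellFormed

variable {t t' : UTree Lab}

theorem row_singleton_iff (ht : t.WellFormed) {l : Option Lab} {x : Ident} :
    t.Row l [x] ↔ l = none ∧ (x = .data ∨ x = .mem) := by
  obtain ⟨⟨d, m, rfl⟩, -⟩ := ht
  have hd : ¬ d.Row l [] := fun h => h.ne_nil rfl
  have hm : ¬ m.Row l [] := fun h => h.ne_nil rfl
  refine (Forest.row_cons (s := d) (r := .cons none .mem m .nil)).trans ?_
  simp [hd, hm, eq_comm, and_or_left]

/-- The reserved identifiers occur at the root only. -/
theorem row_of_suffix (ht : t.WellFormed) {l : Option Lab} {π : List Ident} {x : Ident}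
    (hx : x = .data ∨ x = .mem) (h : t.Row l π) (hπ : [x] <:+ π) : l = none ∧ π = [x] :=
  h.unique ht.2 (ht.row_singleton_iff.2 ⟨rfl, hx⟩) hπ List.suffix_rfl

theorem mem_ids_iff (ht : t.WellFormed) {x : Ident} :
    x ∈ t.ids ↔ x = .data ∨ x = .mem ∨ ∃ l q, t.Edge x l q := by
  constructor
  · intro h
    obtain ⟨l, u, h⟩ := UTree.mem_ids_iff.1 h
    rcases u.eq_nil_or_concat with rfl | ⟨u, q, rfl⟩
    · rcases (ht.row_singleton_iff.1 h).2 with h | h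
      · exact .inl h
      · exact .inr (.inl h)
    · exact .inr (.inr ⟨l, q, _, h, u, by simp⟩)
  · rintro (h | h | ⟨l, q, π, h, hs⟩)
    · exact UTree.mem_ids_iff.2 ⟨none, [], ht.row_singleton_iff.2 ⟨rfl, .inl h⟩⟩
    · exact UTree.mem_ids_iff.2 ⟨none, [], ht.row_singleton_iff.2 ⟨rfl, .inr h⟩⟩
    · exact h.mem_ids (hs.subset (by simp))

/-- Following parents from an edge to the root recovers its path. -/
theorem row_of_edge_iff (ht : t.WellFormed) (ht' : t'.WellFormed)
    (h : ∀ x l q, t.Edge x l q ↔ t'.Edge x l q) {l : Option Lab} {π : List Ident}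
    (hr : t.Row l π) : t'.Row l π := by
  induction π using List.reverseRecOn generalizing l with
  | nil => exact absurd rfl hr.ne_nil
  | append_singleton π x ih =>
    rcases π.eq_nil_or_concat with rfl | ⟨π, q, rfl⟩
    · exact ht'.row_singleton_iff.2 (ht.row_singleton_iff.1 hr)
    · obtain ⟨ρ, hρ, u, rfl⟩ := (h x l q).1 ⟨_, hr, π, by simp⟩
      obtain ⟨l₁, h₁⟩ := hr.of_append (by simp)
      have h₁' := ih h₁
      obtain ⟨l₂, h₂⟩ := Row.of_append (π := u ++ [q]) (π' := [x]) (by simpa using hρ) (by simp)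
      have := (h₁'.unique ht'.2 h₂ (x := q) (by simp) (by simp)).2
      simp only [List.concat_eq_append] at this ⊢
      rw [this]
      simpa using hρ

/-- A well-formed tree is determined by the labels and the parents of its edges. -/
theorem ext (ht : t.WellFormed) (ht' : t'.WellFormed)
    (h : ∀ x l q, t.Edge x l q ↔ t'.Edge x l q) : t = t' :=
  ext_row ht.2 ht'.2 fun _ _ => ⟨ht.row_of_edge_iff ht' h,
    ht'.row_of_edge_iff ht fun x l q => (h x l q).symm⟩

end WellFormed

end UTree

/-! ### The effect of the operations on parents -/

namespace TreeOp

open UTree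

variable {Lab : Type u} {noValue : Lab} {t : UTree Lab}

theorem row_add (ht : t.WellFormed) {p : Ident} {id : ℕ × ℕ} (hid : .node id ∉ t.ids)
    {l : Option Lab} {π : List Ident} : (apply noValue t (add p id)).Row l π ↔
      t.Row l π ∨ l = some noValue ∧ ∃ u l', t.Row l' (u ++ [p]) ∧ π = u ++ [p, .node id] := by
  simp only [apply, hid, if_false, row_addTree ht.2, row_leaf]
  refine or_congr_right ⟨?_, ?_⟩
  · rintro ⟨u, v, l', h, ⟨rfl, rfl⟩, rfl⟩
    exact ⟨rfl, u, l', h, rfl⟩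
  · rintro ⟨rfl, u, l', h, rfl⟩
    exact ⟨u, _, l', h, ⟨rfl, rfl⟩, rfl⟩

theorem row_mv (ht : t.WellFormed) {p : Ident} {id : ℕ × ℕ} {l : Option Lab} {π : List Ident} :
    (apply noValue t (mv id p)).Row l π ↔ (t.Row l π ∧ .node id ∉ π) ∨
      ∃ u v w l', t.Row l' (u ++ [p]) ∧ .node id ∉ u ++ [p] ∧ t.Row l (w ++ .node id :: v) ∧
        π = u ++ p :: .node id :: v := by
  simp only [apply, row_addTree (nodup_erase ht.2), row_erase, row_projEdge ht.2]
  refine or_congr_right ⟨?_, ?_⟩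
  · rintro ⟨u, v, l', ⟨h₁, h₂⟩, ⟨w, v, rfl, h₃⟩, rfl⟩
    exact ⟨u, v, w, l', h₁, h₂, h₃, rfl⟩
  · rintro ⟨u, v, w, l', h₁, h₂, h₃, rfl⟩
    exact ⟨u, _, l', ⟨h₁, h₂⟩, ⟨w, v, rfl, h₃⟩, rfl⟩

theorem row_del (ht : t.WellFormed) {id : ℕ × ℕ} {l : Option Lab} {π : List Ident} :
    (apply noValue t (del id)).Row l π ↔ (t.Row l π ∧ .node id ∉ π) ∨
      ∃ v w, v ≠ [] ∧ t.Row l (w ++ .node id :: v) ∧ π = .mem :: v := by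
  simp only [apply, row_addTree (nodup_erase ht.2), row_erase, row_proj ht.2]
  refine or_congr_right ⟨?_, ?_⟩
  · rintro ⟨u, v, l', ⟨h₁, h₂⟩, ⟨hv, w, h₃⟩, rfl⟩
    have := (ht.row_of_suffix (.inr rfl) h₁ (by simp)).2
    obtain rfl : u = [] := by simpa using this
    exact ⟨v, w, hv, h₃, rfl⟩
  · rintro ⟨v, w, hv, h₃, rfl⟩
    exact ⟨[], v, none, ⟨ht.row_singleton_iff.2 ⟨rfl, .inr rfl⟩, by simp⟩, ⟨hv, w, h₃⟩, rfl⟩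

theorem edge_add (ht : t.WellFormed) {p : Ident} {id : ℕ × ℕ} (hid : .node id ∉ t.ids)
    (hp : p ∈ t.ids) {x q : Ident} {l : Option Lab} :
    (apply noValue t (add p id)).Edge x l q ↔
      t.Edge x l q ∨ l = some noValue ∧ x = .node id ∧ q = p := by
  simp only [Edge, row_add ht hid]
  constructor
  · rintro ⟨π, h | ⟨rfl, u, l', h, rfl⟩, hs⟩
    · exact .inl ⟨π, h, hs⟩
    · exact .inr ⟨rfl, (pair_suffix_append.1 hs).symm⟩
  · rintro (⟨π, h, hs⟩ | ⟨rfl, rfl, rfl⟩)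
    · exact ⟨π, .inl h, hs⟩
    · obtain ⟨l', u, h⟩ := mem_ids_iff.1 hp
      exact ⟨_, .inr ⟨rfl, u, l', h, rfl⟩, List.suffix_append _ _⟩

/-- The last edge of a path differs from all edges above it. -/
theorem ne_of_row (ht : t.WellFormed) {l : Option Lab} {w v : List Ident} {a x : Ident}
    (h : t.Row l (w ++ a :: v)) (hx : [x] <:+ v) : x ≠ a := by
  rintro rfl
  have := (List.nodup_append.1 (h.nodup ht.2)).2.1
  exact (List.nodup_cons.1 this).1 (hx.subset (by simp))

theorem edge_del (ht : t.WellFormed) {id : ℕ × ℕ} {x q : Ident} {l : Option Lab} :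
    (apply noValue t (del id)).Edge x l q ↔ x ≠ .node id ∧
      (t.Edge x l q ∧ q ≠ .node id ∨ t.Edge x l (.node id) ∧ q = .mem) := by
  simp only [Edge, row_del ht]
  constructor
  · rintro ⟨π, ⟨h, hn⟩ | ⟨v, w, hv, h, rfl⟩, hs⟩
    · have h₁ : x ∈ π := hs.subset (by simp)
      have h₂ : q ∈ π := hs.subset (by simp)
      exact ⟨fun e => hn (e ▸ h₁), .inl ⟨⟨π, h, hs⟩, fun e => hn (e ▸ h₂)⟩⟩
    · have hx : [x] <:+ v := by
        have := singleton_suffix_of_pair hs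
        rwa [singleton_suffix_cons hv] at this
      refine ⟨ne_of_row ht h hx, ?_⟩
      rcases List.suffix_cons_iff.1 hs with e | hs
      · obtain ⟨rfl, rfl⟩ : q = .mem ∧ [x] = v := by simpa using e
        exact .inr ⟨⟨_, h, List.suffix_append _ _⟩, rfl⟩
      · refine .inl ⟨⟨_, h, (hs.trans (List.suffix_cons _ _)).trans (List.suffix_append _ _)⟩, ?_⟩
        rintro rfl
        have := (List.nodup_append.1 (h.nodup ht.2)).2.1
        exact (List.nodup_cons.1 this).1 (hs.subset (by simp))
  · rintro ⟨hx, ⟨⟨π, h, hs⟩, hq⟩ | ⟨⟨π, h, hs⟩, rfl⟩⟩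
    · by_cases hn : .node id ∈ π
      · obtain ⟨w, v, rfl⟩ := List.append_of_mem hn
        have hv : v ≠ [] := by
          rintro rfl
          exact hx (singleton_suffix_append.1 (singleton_suffix_of_pair hs))
        refine ⟨.mem :: v, .inr ⟨v, w, hv, h, rfl⟩, ?_⟩
        rcases List.suffix_cons_iff.1 ((pair_suffix_append_cons hv).1 hs) with e | hs
        · exact absurd (List.cons.inj e).1 hq
        · exact hs.trans (List.suffix_cons _ _)
      · exact ⟨π, .inl ⟨h, hn⟩, hs⟩
    · obtain ⟨u, rfl⟩ := hs
      exact ⟨[.mem, x], .inr ⟨[x], u, by simp, h, rfl⟩, List.suffix_rfl⟩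

/-- Moving an edge to a place that is not below it changes its parent and nothing else. -/
theorem edge_mv (ht : t.WellFormed) {p : Ident} {id : ℕ × ℕ} (hp : p ∈ t.ids)
    (hu : ¬ t.Under (.node id) p) {x q : Ident} {l : Option Lab} :
    (apply noValue t (mv id p)).Edge x l q ↔ (x ≠ .node id ∧ t.Edge x l q) ∨
      (x = .node id ∧ q = p ∧ ∃ q', t.Edge x l q') := by
  obtain ⟨lp, up, hrp⟩ := mem_ids_iff.1 hp
  have hup : .node id ∉ up ++ [p] := fun h => hu ⟨lp, _, hrp, by simp, h⟩
  constructor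
  · rintro ⟨π, hr, hs⟩
    rcases (row_mv ht).1 hr with ⟨h, hn⟩ | ⟨u, v, w, l', h₁, h₂, h₃, rfl⟩
    · exact .inl ⟨fun e => hn (e ▸ hs.subset (by simp)), π, h, hs⟩
    · by_cases hv : v = []
      · subst hv
        obtain ⟨rfl, rfl⟩ := pair_suffix_append.1 hs
        rcases w.eq_nil_or_concat with rfl | ⟨w, q', rfl⟩
        · exact absurd (ht.row_singleton_iff.1 h₃).2 (by simp)
        · exact .inr ⟨rfl, rfl, q', _, h₃, by simp⟩
      · have e : u ++ p :: .node id :: v = (u ++ [p]) ++ .node id :: v := by simp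
        rw [e, pair_suffix_append_cons hv] at hs
        refine .inl ⟨ne_of_row ht h₃ ?_, _, h₃, (pair_suffix_append_cons hv).2 hs⟩
        have := singleton_suffix_of_pair hs
        rwa [singleton_suffix_cons hv] at this
  · rintro (⟨hx, π, h, hs⟩ | ⟨rfl, rfl, q', π, h, hs⟩)
    · by_cases hn : .node id ∈ π
      · obtain ⟨w, v, rfl⟩ := List.append_of_mem hn
        have hv : v ≠ [] := by
          rintro rfl
          exact hx (singleton_suffix_append.1 (singleton_suffix_of_pair hs))
        refine ⟨up ++ p :: .node id :: v,
          (row_mv ht).2 (.inr ⟨up, v, w, lp, hrp, hup, h, rfl⟩), ?_⟩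
        have e : up ++ p :: .node id :: v = (up ++ [p]) ++ .node id :: v := by simp
        rw [e, pair_suffix_append_cons hv]
        exact (pair_suffix_append_cons hv).1 hs
      · exact ⟨π, (row_mv ht).2 (.inl ⟨h, hn⟩), hs⟩
    · obtain ⟨w, rfl⟩ := hs
      exact ⟨up ++ [q, .node id], (row_mv ht).2 (.inr ⟨up, [], w ++ [q'], lp, hrp, hup,
        by simpa using h, rfl⟩), List.suffix_append _ _⟩

/-- Moving an edge below itself erases it with everything below it. -/
theorem edge_mv_of_under (ht : t.WellFormed) {p : Ident} {id : ℕ × ℕ}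
    (hu : t.Under (.node id) p) {x q : Ident} {l : Option Lab} :
    (apply noValue t (mv id p)).Edge x l q ↔ t.Edge x l q ∧ ¬ t.Under (.node id) x := by
  obtain ⟨lp, πp, hrp, hsp, hup⟩ := hu
  have hrow : ∀ {l π}, (apply noValue t (mv id p)).Row l π ↔ t.Row l π ∧ .node id ∉ π := by
    intro l π
    rw [row_mv ht]
    refine or_iff_left ?_
    rintro ⟨u, v, w, l', h₁, h₂, -⟩
    exact h₂ ((h₁.unique ht.2 hrp (by simp) hsp).2 ▸ hup)
  simp only [Edge, hrow]
  constructor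
  · rintro ⟨π, ⟨h, hn⟩, hs⟩
    refine ⟨⟨π, h, hs⟩, ?_⟩
    rintro ⟨l', π', h', hs', hn'⟩
    exact hn ((h.unique ht.2 h' (singleton_suffix_of_pair hs) hs').2 ▸ hn')
  · rintro ⟨⟨π, h, hs⟩, hn⟩
    exact ⟨π, ⟨h, fun hmem => hn ⟨l, π, h, singleton_suffix_of_pair hs, hmem⟩⟩, hs⟩

theorem edge_ren (ht : t.WellFormed) {id : ℕ × ℕ} {l₀ : Lab} {x q : Ident} {l : Option Lab} :
    (apply noValue t (ren id l₀)).Edge x l q ↔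
      ∃ l', t.Edge x l' q ∧ (x = .node id ∧ l = some l₀ ∨ x ≠ .node id ∧ l = l') := by
  simp only [Edge, apply, row_rename ht.2]
  have hs' : ∀ {π : List Ident}, [q, x] <:+ π → ([.node id] <:+ π ↔ x = .node id) := by
    rintro π ⟨u, rfl⟩
    have e : u ++ [q, x] = (u ++ [q]) ++ [x] := by simp
    rw [e, singleton_suffix_append, eq_comm]
  constructor
  · rintro ⟨π, ⟨l', h, h'⟩, hs⟩
    rw [hs' hs] at h'
    exact ⟨l', ⟨π, h, hs⟩, h'⟩
  · rintro ⟨l', ⟨π, h, hs⟩, h'⟩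
    exact ⟨π, ⟨l', h, by rwa [hs' hs]⟩, hs⟩

theorem under_of_under_add (ht : t.WellFormed) {p a x : Ident} {id : ℕ × ℕ}
    (hid : .node id ∉ t.ids) (hx : x ≠ .node id)
    (h : (apply noValue t (add p id)).Under a x) : t.Under a x := by
  obtain ⟨l, π, h, hs, ha⟩ := h
  rcases (row_add ht hid).1 h with h | ⟨rfl, u, l', h, rfl⟩
  · exact ⟨l, π, h, hs, ha⟩
  · have e : u ++ [p, .node id] = (u ++ [p]) ++ [.node id] := by simp
    rw [e, singleton_suffix_append] at hs
    exact absurd hs hx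

theorem under_of_under_del (ht : t.WellFormed) {a x : Ident} {id : ℕ × ℕ} (ha : a ≠ .mem)
    (h : (apply noValue t (del id)).Under a x) : t.Under a x := by
  obtain ⟨l, π, h, hs, hmem⟩ := h
  rcases (row_del ht).1 h with ⟨h, -⟩ | ⟨v, w, hv, h', rfl⟩
  · exact ⟨l, π, h, hs, hmem⟩
  · rw [singleton_suffix_cons hv] at hs
    have : a ∈ v := by simpa [ha] using hmem
    exact ⟨l, _, h', (hs.trans (List.suffix_cons _ _)).trans (List.suffix_append _ _),
      by simp [this]⟩

theorem under_of_under_ren (ht : t.WellFormed) {a x : Ident} {id : ℕ × ℕ} {l₀ : Lab}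
    (h : (apply noValue t (ren id l₀)).Under a x) : t.Under a x := by
  obtain ⟨l, π, h, hs, hmem⟩ := h
  obtain ⟨l', h, -⟩ := (row_rename ht.2).1 h
  exact ⟨l', π, h, hs, hmem⟩

/-- After a move, an identifier is newly below `b` exactly if it was moved to a place below `b`. -/
theorem under_mv_iff (ht : t.WellFormed) {p b x : Ident} {id : ℕ × ℕ}
    (hu : ¬ t.Under (.node id) p) (hb : ¬ t.Under b x) :
    (apply noValue t (mv id p)).Under b x ↔ t.Under (.node id) x ∧ t.Under b p := by
  constructor
  · rintro ⟨l, π, h, hs, hmem⟩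
    rcases (row_mv ht).1 h with ⟨h, hn⟩ | ⟨u, v, w, l', h₁, h₂, h₃, rfl⟩
    · exact absurd ⟨l, π, h, hs, hmem⟩ hb
    · have e : u ++ p :: .node id :: v = (u ++ [p]) ++ .node id :: v := by simp
      rw [e, suffix_append_of_ne_nil (by simp)] at hs
      have hs' := hs.trans (List.suffix_append w _)
      rw [e, List.mem_append] at hmem
      refine ⟨⟨l, _, h₃, hs', by simp⟩, l', _, h₁, by simp, hmem.resolve_right fun hmem => ?_⟩
      exact hb ⟨l, _, h₃, hs', List.mem_append_right w hmem⟩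
  · rintro ⟨⟨l, π, h, hs, hmem⟩, l', π', h', ⟨u, rfl⟩, hmem'⟩
    obtain ⟨w, v, rfl⟩ := List.append_of_mem hmem
    have hn : .node id ∉ u ++ [p] := fun h => hu ⟨l', _, h', by simp, h⟩
    refine ⟨l, _, (row_mv ht).2 (.inr ⟨u, v, w, l', h', hn, h, rfl⟩), ?_, ?_⟩
    · have e : u ++ p :: .node id :: v = (u ++ [p]) ++ .node id :: v := by simp
      rw [e, suffix_append_of_ne_nil (by simp)]
      rwa [suffix_append_of_ne_nil (by simp)] at hs
    · have e : u ++ p :: .node id :: v = (u ++ [p]) ++ .node id :: v := by simp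
      rw [e, List.mem_append]
      exact .inl hmem'

/-- What is below `b` stays there if the edge is moved to a place below `b`. -/
theorem under_mv_of_under (ht : t.WellFormed) {p b x : Ident} {id : ℕ × ℕ}
    (hu : ¬ t.Under (.node id) p) (hp : t.Under b p) (hb : t.Under b x) :
    (apply noValue t (mv id p)).Under b x := by
  obtain ⟨l, π, h, hs, hmem⟩ := hb
  by_cases hn : .node id ∈ π
  · obtain ⟨l', π', h', ⟨u, rfl⟩, hmem'⟩ := hp
    obtain ⟨w, v, rfl⟩ := List.append_of_mem hn
    have hn : .node id ∉ u ++ [p] := fun h => hu ⟨l', _, h', by simp, h⟩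
    have e : u ++ p :: .node id :: v = (u ++ [p]) ++ .node id :: v := by simp
    refine ⟨l, _, (row_mv ht).2 (.inr ⟨u, v, w, l', h', hn, h, rfl⟩), ?_, ?_⟩
    · rw [e, suffix_append_of_ne_nil (by simp)]
      rwa [suffix_append_of_ne_nil (by simp)] at hs
    · rw [e, List.mem_append]
      exact .inl hmem'
  · exact ⟨l, π, (row_mv ht).2 (.inl ⟨h, hn⟩), hs, hmem⟩

end TreeOp

/-! ### Transforming concurrent tree operations -/

namespace TreeOp

open UTree

variable {Lab : Type u} {noValue : Lab} {t : UTree Lab}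

theorem apply_nop : apply noValue t nop = t := rfl

theorem mem_ids_add (ht : t.WellFormed) {p x : Ident} {id : ℕ × ℕ} (hid : .node id ∉ t.ids)
    (hp : p ∈ t.ids) :
    x ∈ (apply noValue t (add p id)).ids ↔ x ∈ t.ids ∨ x = .node id := by
  rw [ht.mem_ids_iff, (apply_wellFormed noValue ht _).mem_ids_iff]
  simp only [edge_add ht hid hp]
  grind

theorem mem_ids_del (ht : t.WellFormed) {x : Ident} {id : ℕ × ℕ} :
    x ∈ (apply noValue t (del id)).ids ↔ x ∈ t.ids ∧ x ≠ .node id := by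
  rw [ht.mem_ids_iff, (apply_wellFormed noValue ht _).mem_ids_iff]
  simp only [edge_del ht]
  grind

theorem mem_ids_mv (ht : t.WellFormed) {p x : Ident} {id : ℕ × ℕ} (hp : p ∈ t.ids)
    (hu : ¬ t.Under (.node id) p) : x ∈ (apply noValue t (mv id p)).ids ↔ x ∈ t.ids := by
  rw [ht.mem_ids_iff, (apply_wellFormed noValue ht _).mem_ids_iff]
  simp only [edge_mv ht hp hu]
  grind

theorem mem_ids_ren {x : Ident} {id : ℕ × ℕ} {l₀ : Lab} :
    x ∈ (apply noValue t (ren id l₀)).ids ↔ x ∈ t.ids := by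
  induction t using Quotient.inductionOn with | h t =>
  exact iff_of_eq (congrArg (x ∈ ·) (Forest.ids_rename _ _ t))

/-- The part of the precondition of an operation that concerns the tree. The identifier to be added
is new. -/
def Valid (t : UTree Lab) : TreeOp Lab → Prop
  | add p id => .node id ∉ t.ids ∧ p ∈ t.ids
  | del id => .node id ∈ t.ids
  | mv id p => .node id ∈ t.ids ∧ p ∈ t.ids ∧ ¬ t.Under (.node id) p
  | ren id _ => .node id ∈ t.ids
  | nop => True

theorem add_add_comm (ht : t.WellFormed) {p p' : Ident} {id id' : ℕ × ℕ} (hne : id ≠ id')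
    (h : Valid t (add p id)) (h' : Valid t (add p' id')) :
    apply noValue (apply noValue t (add p id)) (add p' id') =
      apply noValue (apply noValue t (add p' id')) (add p id) := by
  have w := apply_wellFormed noValue ht (add p id)
  have w' := apply_wellFormed noValue ht (add p' id')
  refine (apply_wellFormed noValue w _).ext (apply_wellFormed noValue w' _) fun x l q => ?_
  rw [edge_add w, edge_add w', edge_add ht h.1 h.2, edge_add ht h'.1 h'.2]
  · grind
  · simp [mem_ids_add ht h'.1 h'.2, h.1, hne]
  · simp [mem_ids_add ht h'.1 h'.2, h.2]
  · simp [mem_ids_add ht h.1 h.2, h'.1, hne.symm]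
  · simp [mem_ids_add ht h.1 h.2, h'.2]

theorem add_ren_comm (ht : t.WellFormed) {p : Ident} {id id' : ℕ × ℕ} {l₀ : Lab}
    (h : Valid t (add p id)) (h' : Valid t (ren id' l₀)) :
    apply noValue (apply noValue t (add p id)) (ren id' l₀) =
      apply noValue (apply noValue t (ren id' l₀)) (add p id) := by
  have w := apply_wellFormed noValue ht (add p id)
  have w' := apply_wellFormed noValue ht (ren id' l₀)
  have hne : id' ≠ id := by rintro rfl; exact h.1 h'
  refine (apply_wellFormed noValue w _).ext (apply_wellFormed noValue w' _) fun x l q => ?_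
  rw [edge_add w', edge_ren w, edge_ren ht]
  · simp only [edge_add ht h.1 h.2]
    by_cases hx : x = .node id
    · subst hx; simp [hne.symm]
    · simp [hx]
  · rw [mem_ids_ren]; exact h.1
  · rw [mem_ids_ren]; exact h.2

theorem add_mv_comm (ht : t.WellFormed) {p p' : Ident} {id id' : ℕ × ℕ}
    (h : Valid t (add p id)) (h' : Valid t (mv id' p')) :
    apply noValue (apply noValue t (add p id)) (mv id' p') =
      apply noValue (apply noValue t (mv id' p')) (add p id) := by
  have w := apply_wellFormed noValue ht (add p id)
  have w' := apply_wellFormed noValue ht (mv id' p')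
  have hne : id' ≠ id := by rintro rfl; exact h.1 h'.1
  have hp' : p' ≠ .node id := by rintro rfl; exact h.1 h'.2.1
  refine (apply_wellFormed noValue w _).ext (apply_wellFormed noValue w' _) fun x l q => ?_
  rw [edge_add w', edge_mv w, edge_mv ht h'.2.1 h'.2.2]
  · simp only [edge_add ht h.1 h.2]
    grind
  · rw [mem_ids_add ht h.1 h.2]; exact .inl h'.2.1
  · exact fun hu => h'.2.2 (under_of_under_add ht h.1 hp' hu)
  · rw [mem_ids_mv ht h'.2.1 h'.2.2]; exact h.1
  · rw [mem_ids_mv ht h'.2.1 h'.2.2]; exact h.2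

theorem add_del_comm (ht : t.WellFormed) {p : Ident} {id id' : ℕ × ℕ} (hp : p ≠ .node id')
    (h : Valid t (add p id)) (h' : Valid t (del id')) :
    apply noValue (apply noValue t (add p id)) (del id') =
      apply noValue (apply noValue t (del id')) (add p id) := by
  have w := apply_wellFormed noValue ht (add p id)
  have w' := apply_wellFormed noValue ht (del id')
  have hne : id' ≠ id := by rintro rfl; exact h.1 h'
  refine (apply_wellFormed noValue w _).ext (apply_wellFormed noValue w' _) fun x l q => ?_
  rw [edge_add w', edge_del w, edge_del ht]
  · simp only [edge_add ht h.1 h.2]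
    grind
  · rw [mem_ids_del ht]; exact fun hm => h.1 hm.1
  · rw [mem_ids_del ht]; exact ⟨h.2, hp⟩

/-- Adding below a deleted edge amounts to adding to the memory. -/
theorem add_del (ht : t.WellFormed) {id id' : ℕ × ℕ}
    (h : Valid t (add (.node id') id)) (h' : Valid t (del id')) :
    apply noValue (apply noValue t (add (.node id') id)) (del id') =
      apply noValue (apply noValue t (del id')) (add .mem id) := by
  have w := apply_wellFormed noValue ht (add (.node id') id)
  have w' := apply_wellFormed noValue ht (del id')
  have hne : id' ≠ id := by rintro rfl; exact h.1 h'
  refine (apply_wellFormed noValue w _).ext (apply_wellFormed noValue w' _) fun x l q => ?_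
  rw [edge_add w', edge_del w, edge_del ht]
  · simp only [edge_add ht h.1 h.2]
    grind
  · rw [mem_ids_del ht]; exact fun hm => h.1 hm.1
  · rw [mem_ids_del ht]; exact ⟨ht.mem_ids_iff.2 (.inr (.inl rfl)), by simp⟩

theorem ren_ren_comm (ht : t.WellFormed) {id id' : ℕ × ℕ} {l₀ l₁ : Lab} (hne : id ≠ id') :
    apply noValue (apply noValue t (ren id l₀)) (ren id' l₁) =
      apply noValue (apply noValue t (ren id' l₁)) (ren id l₀) := by
  have w := apply_wellFormed noValue ht (ren id l₀)
  have w' := apply_wellFormed noValue ht (ren id' l₁)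
  refine (apply_wellFormed noValue w _).ext (apply_wellFormed noValue w' _) fun x l q => ?_
  rw [edge_ren w, edge_ren w']
  simp only [edge_ren ht]
  by_cases hx : x = .node id
  · subst hx; simp [hne]
  · simp [hx]

theorem ren_ren_self (ht : t.WellFormed) {id : ℕ × ℕ} {l₀ l₁ : Lab} :
    apply noValue (apply noValue t (ren id l₀)) (ren id l₁) = apply noValue t (ren id l₁) := by
  have w := apply_wellFormed noValue ht (ren id l₀)
  refine (apply_wellFormed noValue w _).ext (apply_wellFormed noValue ht _) fun x l q => ?_
  rw [edge_ren w, edge_ren ht]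
  simp only [edge_ren ht]
  by_cases hx : x = .node id <;> simp [hx]

theorem ren_mv_comm (ht : t.WellFormed) {p : Ident} {id id' : ℕ × ℕ} {l₀ : Lab}
    (h : Valid t (mv id p)) :
    apply noValue (apply noValue t (ren id' l₀)) (mv id p) =
      apply noValue (apply noValue t (mv id p)) (ren id' l₀) := by
  have w := apply_wellFormed noValue ht (ren id' l₀)
  have w' := apply_wellFormed noValue ht (mv id p)
  refine (apply_wellFormed noValue w _).ext (apply_wellFormed noValue w' _) fun x l q => ?_
  rw [edge_mv w, edge_ren w']
  · simp only [edge_mv ht h.2.1 h.2.2, edge_ren ht]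
    by_cases hx : x = .node id
    · subst hx; by_cases hx' : id = id'
      · subst hx'; simp only [true_and]; grind
      · simp [hx']
    · simp [hx]
  · rw [mem_ids_ren]; exact h.2.1
  · exact fun hu => h.2.2 (under_of_under_ren ht hu)

theorem ren_del_comm (ht : t.WellFormed) {id id' : ℕ × ℕ} {l₀ : Lab} :
    apply noValue (apply noValue t (ren id l₀)) (del id') =
      apply noValue (apply noValue t (del id')) (ren id l₀) := by
  have w := apply_wellFormed noValue ht (ren id l₀)
  have w' := apply_wellFormed noValue ht (del id')
  refine (apply_wellFormed noValue w _).ext (apply_wellFormed noValue w' _) fun x l q => ?_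
  rw [edge_del w, edge_ren w']
  simp only [edge_ren ht, edge_del ht]
  grind

theorem del_del_comm (ht : t.WellFormed) {id id' : ℕ × ℕ} :
    apply noValue (apply noValue t (del id)) (del id') =
      apply noValue (apply noValue t (del id')) (del id) := by
  have w := apply_wellFormed noValue ht (del id)
  have w' := apply_wellFormed noValue ht (del id')
  refine (apply_wellFormed noValue w _).ext (apply_wellFormed noValue w' _) fun x l q => ?_
  rw [edge_del w, edge_del w']
  simp only [edge_del ht]
  grind

theorem mv_del_comm (ht : t.WellFormed) {p : Ident} {id id' : ℕ × ℕ} (hp : p ≠ .node id')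
    (h : Valid t (mv id p)) :
    apply noValue (apply noValue t (mv id p)) (del id') =
      apply noValue (apply noValue t (del id')) (mv id p) := by
  have w := apply_wellFormed noValue ht (mv id p)
  have w' := apply_wellFormed noValue ht (del id')
  refine (apply_wellFormed noValue w _).ext (apply_wellFormed noValue w' _) fun x l q => ?_
  rw [edge_mv w', edge_del w]
  · simp only [edge_mv ht h.2.1 h.2.2, edge_del ht]
    grind
  · rw [mem_ids_del ht]; exact ⟨h.2.1, hp⟩
  · exact fun hu => h.2.2 (under_of_under_del ht (by simp) hu)

/-- Moving a subtree below a deleted edge amounts to moving it to the memory. -/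
theorem mv_del (ht : t.WellFormed) {id id' : ℕ × ℕ} (h : Valid t (mv id (.node id'))) :
    apply noValue (apply noValue t (mv id (.node id'))) (del id') =
      apply noValue (apply noValue t (del id')) (mv id .mem) := by
  have w := apply_wellFormed noValue ht (mv id (.node id'))
  have w' := apply_wellFormed noValue ht (del id')
  have hne : id ≠ id' := by rintro rfl; exact h.2.2 (Under.refl h.1)
  refine (apply_wellFormed noValue w _).ext (apply_wellFormed noValue w' _) fun x l q => ?_
  rw [edge_mv w', edge_del w]
  · simp only [edge_mv ht h.2.1 h.2.2, edge_del ht]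
    grind
  · rw [mem_ids_del ht]; exact ⟨ht.mem_ids_iff.2 (.inr (.inl rfl)), by simp⟩
  · rintro ⟨l, π, hr, hs, hmem⟩
    rw [(w'.row_of_suffix (.inr rfl) hr hs).2] at hmem
    simp at hmem

theorem mv_del_self (ht : t.WellFormed) {p : Ident} {id : ℕ × ℕ} (h : Valid t (mv id p)) :
    apply noValue (apply noValue t (mv id p)) (del id) = apply noValue t (del id) := by
  have w := apply_wellFormed noValue ht (mv id p)
  refine (apply_wellFormed noValue w _).ext (apply_wellFormed noValue ht _) fun x l q => ?_
  rw [edge_del w, edge_del ht]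
  simp only [edge_mv ht h.2.1 h.2.2]
  grind

theorem mv_mv_self (ht : t.WellFormed) {p p' : Ident} {id : ℕ × ℕ} (h : Valid t (mv id p))
    (h' : Valid t (mv id p')) :
    apply noValue (apply noValue t (mv id p)) (mv id p') = apply noValue t (mv id p') := by
  have w := apply_wellFormed noValue ht (mv id p)
  refine (apply_wellFormed noValue w _).ext (apply_wellFormed noValue ht _) fun x l q => ?_
  rw [edge_mv w, edge_mv ht h'.2.1 h'.2.2]
  · simp only [edge_mv ht h.2.1 h.2.2]
    grind
  · rw [mem_ids_mv ht h.2.1 h.2.2]; exact h'.2.1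
  · rw [under_mv_iff ht h.2.2 h'.2.2]; exact fun hu => h.2.2 hu.2

/-- The parents after two moves that were generated on the same tree. If each of them moves to a
place below the other moved edge, both subtrees are lost; otherwise both edges get their new
parents. In either case the description is symmetric in the two moves. -/
theorem edge_mv_mv (ht : t.WellFormed) {p p' : Ident} {id id' : ℕ × ℕ} (hne : id ≠ id')
    (h : Valid t (mv id p)) (h' : Valid t (mv id' p')) {x q : Ident} {l : Option Lab} :
    (apply noValue (apply noValue t (mv id p)) (mv id' p')).Edge x l q ↔
      ((t.Under (.node id) p' ∧ t.Under (.node id') p) ∧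
        t.Edge x l q ∧ ¬ t.Under (.node id) x ∧ ¬ t.Under (.node id') x) ∨
      (¬ (t.Under (.node id) p' ∧ t.Under (.node id') p) ∧
        ((x ≠ .node id ∧ x ≠ .node id' ∧ t.Edge x l q) ∨
        (x = .node id ∧ q = p ∧ ∃ q', t.Edge x l q') ∨
        (x = .node id' ∧ q = p' ∧ ∃ q', t.Edge x l q'))) := by
  have w := apply_wellFormed noValue ht (mv id p)
  have hcycle := under_mv_iff (noValue := noValue) ht h.2.2 h'.2.2
  by_cases hc : t.Under (.node id) p' ∧ t.Under (.node id') p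
  · rw [edge_mv_of_under w (hcycle.2 hc), edge_mv ht h.2.1 h.2.2]
    have hx : (apply noValue t (mv id p)).Under (.node id') x ↔
        t.Under (.node id) x ∨ t.Under (.node id') x := by
      by_cases hu : t.Under (.node id') x
      · simp [hu, under_mv_of_under ht h.2.2 hc.2 hu]
      · simp [hu, under_mv_iff ht h.2.2 hu, hc.2]
    have hself : x = .node id → t.Under (.node id) x := by
      rintro rfl; exact Under.refl h.1
    rw [hx]
    tauto
  · rw [edge_mv w _ (fun hu => hc (hcycle.1 hu))]
    · simp only [edge_mv ht h.2.1 h.2.2]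
      grind
    · rw [mem_ids_mv ht h.2.1 h.2.2]; exact h'.2.1

theorem mv_mv_comm (ht : t.WellFormed) {p p' : Ident} {id id' : ℕ × ℕ} (hne : id ≠ id')
    (h : Valid t (mv id p)) (h' : Valid t (mv id' p')) :
    apply noValue (apply noValue t (mv id p)) (mv id' p') =
      apply noValue (apply noValue t (mv id' p')) (mv id p) := by
  have w := apply_wellFormed noValue ht (mv id p)
  have w' := apply_wellFormed noValue ht (mv id' p')
  refine (apply_wellFormed noValue w _).ext (apply_wellFormed noValue w' _) fun x l q => ?_
  rw [edge_mv_mv ht hne h h', edge_mv_mv ht hne.symm h' h]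
  grind

/-- Deletions are executed after the other operations of equal clock. -/
def rank : TreeOp Lab → ℕ
  | del _ => 1
  | _ => 0

/-- The operation that comes later in the execution order is not transformed. -/
theorem IT_eq_of_before {s₁ s₂ : Site} {o₁ o₂ : TreeOp Lab}
    (hlt : rank o₁ < rank o₂ ∨ rank o₁ = rank o₂ ∧ s₂ < s₁) : IT s₂ o₂ s₁ o₁ = o₂ := by
  cases o₁ <;> cases o₂ <;> simp_all [rank, IT]
  all_goals intro h; exact absurd hlt h.not_gt

/-- The operation that comes earlier in the execution order is transformed in such a way that
executing it afterwards has the effect of executing both operations in this order. -/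
theorem apply_IT_of_before (ht : t.WellFormed) {s₁ s₂ : Site} {o₁ o₂ : TreeOp Lab}
    (h₁ : Valid t o₁) (h₂ : Valid t o₂)
    (hne : ∀ p₁ id₁ p₂ id₂, o₁ = add p₁ id₁ → o₂ = add p₂ id₂ → id₁ ≠ id₂)
    (hlt : rank o₁ < rank o₂ ∨ rank o₁ = rank o₂ ∧ s₂ < s₁) :
    apply noValue (apply noValue t o₂) (IT s₁ o₁ s₂ o₂) =
      apply noValue (apply noValue t o₁) o₂ := by
  cases o₁ with
  | add p id =>
    cases o₂ with
    | add p' id' => exact (add_add_comm ht (hne _ _ _ _ rfl rfl) h₁ h₂).symm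
    | del id' =>
      have hid : id ≠ id' := by rintro rfl; exact h₁.1 h₂
      by_cases hp : p = .node id'
      · subst hp
        simpa only [IT, if_neg hid, if_true] using (add_del ht h₁ h₂).symm
      · simpa [IT, hid, hp] using (add_del_comm ht hp h₁ h₂).symm
    | mv id' p' => exact (add_mv_comm ht h₁ h₂).symm
    | ren id' l => exact (add_ren_comm ht h₁ h₂).symm
    | nop => rfl
  | del id =>
    cases o₂ with
    | del id' => exact (del_del_comm ht).symm
    | add | mv | ren | nop => simp [rank] at hlt
  | mv id p =>
    cases o₂ with
    | add p' id' => exact add_mv_comm ht h₂ h₁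
    | del id' =>
      by_cases hp : p = .node id'
      · subst hp
        simpa [IT] using (mv_del ht h₁).symm
      · by_cases hid : id = id'
        · subst hid
          simpa only [IT, if_neg hp, if_true, apply_nop] using (mv_del_self ht h₁).symm
        · simpa [IT, hp, hid] using (mv_del_comm ht hp h₁).symm
    | mv id' p' =>
      by_cases hid : id = id'
      · subst hid
        have hs : s₂ < s₁ := by simpa [rank] using hlt
        simpa only [IT, hs, and_self, if_true, apply_nop] using (mv_mv_self ht h₁ h₂).symm
      · simpa [IT, hid] using (mv_mv_comm ht hid h₁ h₂).symm
    | ren id' l => exact ren_mv_comm ht h₁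
    | nop => rfl
  | ren id l =>
    cases o₂ with
    | add p' id' => exact add_ren_comm ht h₂ h₁
    | del id' => exact (ren_del_comm ht).symm
    | mv id' p' => exact (ren_mv_comm ht h₂).symm
    | ren id' l' =>
      by_cases hid : id = id'
      · subst hid
        have hs : s₂ < s₁ := by simpa [rank] using hlt
        simpa only [IT, hs, and_self, if_true, apply_nop] using (ren_ren_self ht).symm
      · simpa [IT, hid] using (ren_ren_comm ht hid).symm
    | nop => rfl
  | nop => cases o₂ <;> rfl

end TreeOp

/-! ### The replay algorithm for trees -/

open EditingAlgorithm

section Trees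

variable {Lab : Type u} {noValue : Lab}

/-- An operation creates no identifiers except the one that it adds. -/
theorem TreeOp.mem_ids_of_mem_apply {t : UTree Lab} {o : TreeOp Lab} {x : Ident}
    (h : x ∈ (TreeOp.apply noValue t o).ids) :
    x ∈ t.ids ∨ ∃ p id, o = TreeOp.add p id ∧ x = .node id := by
  have hadd : ∀ {p : Ident} {s t : Forest Lab}, x ∈ (Forest.addTree p s t).ids →
      x ∈ t.ids ∨ x ∈ s.ids := fun hx => by
    have := Multiset.mem_of_le (Forest.ids_addTree_le _ _ _) hx
    rw [Multiset.mem_add] at this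
    exact this.imp_right fun h => Multiset.mem_of_mem_nsmul h
  induction t using Quotient.inductionOn with | h t =>
  have herase : ∀ {a : Ident}, x ∈ (t.erase a).ids → x ∈ t.ids := fun {a} hx => by
    rw [← Forest.ids_erase_add a t, Multiset.mem_add]; exact .inl hx
  have hproj : ∀ {a : Ident}, x ∈ (t.projEdge a).ids → x ∈ t.ids := fun {a} hx => by
    rw [← Forest.ids_erase_add a t, Multiset.mem_add]; exact .inr hx
  cases o with
  | add p id =>
    by_cases hid : Ident.node id ∈ UTree.ids ⟦t⟧
    · simp only [TreeOp.apply, hid, if_true] at h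
      exact .inl h
    · simp only [TreeOp.apply, hid, if_false] at h
      refine (hadd (s := .cons (some noValue) (.node id) .nil .nil) h).imp_right fun h => ?_
      exact ⟨p, id, rfl, by simpa [Forest.ids] using h⟩
  | del id =>
    exact .inl ((hadd (s := t.proj (.node id)) (t := t.erase (.node id)) h).elim herase fun h =>
      hproj (Multiset.mem_of_le (Forest.ids_proj_le _ _) h))
  | mv id p =>
    exact .inl ((hadd (s := t.projEdge (.node id)) (t := t.erase (.node id)) h).elim herase hproj)
  | ren id l => exact .inl (TreeOp.mem_ids_ren.1 h)
  | nop => exact .inl h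

/-- An identifier of a node occurs only if it has been added. -/
theorem exists_add_of_mem_run {ops : List (TreeOp Lab)} {id : ℕ × ℕ}
    (h : .node id ∈ ((treeObject noValue).run (treeObject noValue).start ops).dom) :
    ∃ p, TreeOp.add p id ∈ ops := by
  induction ops using List.reverseRecOn with
  | nil =>
    have h' : Ident.node id ∈
      Forest.ids (.cons none .data .nil (.cons none .mem .nil .nil) : Forest Lab) := h
    simp [Forest.ids] at h'
  | append_singleton ops o ih =>
    simp only [CollabObject.run, List.foldl_append, List.foldl_cons, List.foldl_nil] at h ih
    rcases TreeOp.mem_ids_of_mem_apply h with h | ⟨p, id', rfl, e⟩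
    · obtain ⟨p, hp⟩ := ih h
      exact ⟨p, by simp [hp]⟩
    · obtain rfl := Ident.node.inj e
      exact ⟨p, by simp⟩

/-- In every computation the identifiers that a site adds bear its number, and no identifier is
added twice. -/
theorem add_origin_and_unique {A : EditingAlgorithm (TreeOp Lab) (XTree Lab)} {c : A.Config}
    (hc : Reachable (treeObject noValue) A c) :
    (∀ k m p id, c.sent k = some m → m.op = TreeOp.add p id → id.1 = m.origin) ∧
    ∀ k m p k' m' p' id, c.sent k = some m → m.op = TreeOp.add p id →
      c.sent k' = some m' → m'.op = TreeOp.add p' id → k = k' := by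
  induction hc with
  | refl => simp [Config.initial]
  | @tail c _ _ hs ih =>
    cases hs with
    | receive => exact ih
    | generate i op k fresh en =>
      obtain ⟨ih₁, ih₂⟩ := ih
      have hsent : ∀ {k' m}, (c.generate i op k).sent k' = some m →
          (k' = k ∧ m.origin = i ∧ m.op = op) ∨ (k' ≠ k ∧ c.sent k' = some m) := by
        intro k' m hm
        by_cases hk : k' = k
        · subst hk
          simp only [Config.generate, Function.update_self, Option.some.injEq] at hm
          subst hm
          exact .inl ⟨rfl, rfl, rfl⟩
        · simp only [Config.generate, Function.update_of_ne hk] at hm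
          exact .inr ⟨hk, hm⟩
      -- the identifier added by the new operation has not been added before
      have hnew : ∀ {p p' id k' m'}, op = TreeOp.add p id → c.sent k' = some m' →
          m'.op = TreeOp.add p' id → False := by
        rintro p p' id k' m' rfl hm' ho
        obtain ⟨h₁, h₂, -⟩ := en
        exact h₂ p' ⟨k', m', hm', (ih₁ _ _ _ _ hm' ho).symm.trans h₁, ho⟩
      refine ⟨fun k' m p id hm ho => ?_, fun k₁ m₁ p₁ k₂ m₂ p₂ id hm₁ ho₁ hm₂ ho₂ => ?_⟩
      · rcases hsent hm with ⟨-, h₁, h₂⟩ | ⟨-, hm⟩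
        · obtain rfl := h₂.symm.trans ho
          exact en.1.trans h₁.symm
        · exact ih₁ _ _ _ _ hm ho
      · rcases hsent hm₁ with ⟨e₁, -, h₁⟩ | ⟨-, hm₁⟩ <;>
          rcases hsent hm₂ with ⟨e₂, -, h₂⟩ | ⟨-, hm₂⟩
        · exact e₁.trans e₂.symm
        · exact (hnew (h₁.symm.trans ho₁) hm₂ ho₂).elim
        · exact (hnew (h₂.symm.trans ho₂) hm₁ ho₁).elim
        · exact ih₂ _ _ _ _ _ _ _ hm₁ ho₁ hm₂ ho₂

theorem TreeOp.valid_of_enabled {i : Site} {past : Set (TreeOp Lab)} {t : XTree Lab}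
    {o : TreeOp Lab} (h : TreeOp.Enabled i past t o)
    (hnew : ∀ p id, o = TreeOp.add p id → .node id ∉ t.dom) : TreeOp.Valid t.1 o := by
  cases o with
  | add p id => exact ⟨hnew p id rfl, h.2.2⟩
  | del id => exact h
  | mv id p => exact ⟨h.1, h.2.1, fun hu => h.2.2 ((UTree.mem_ids_projEdge t.2.2).2 hu)⟩
  | ren id l => exact h
  | nop => trivial

theorem replay_integratesBy :
    (replay (treeObject noValue) TreeOp.rank).IntegratesBy (treeObject noValue) TreeOp.IT := by
  intro c hc j k m k' m' hm hm' hdeps hdone hk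
  have h := ReplayInv.of_reachable hc
  obtain ⟨-, huniq⟩ := add_origin_and_unique hc
  obtain ⟨hne, l, past, past', hl, en, en', hstate, hcases⟩ :=
    h.remoteStep_eq hm hm' hdeps hdone hk
  have hnew : ∀ {k m}, c.sent k = some m → IsLog TreeOp.rank c.sent m.deps l → ∀ p id,
      m.op = TreeOp.add p id → .node id ∉ XTree.dom ((treeObject noValue).replay l) := by
    intro k m hm hl p id ho hmem
    obtain ⟨p', hp'⟩ := exists_add_of_mem_run hmem
    obtain ⟨e, he, ho'⟩ := List.mem_map.1 hp'
    obtain ⟨k₁, hk₁, m₁, hm₁, rfl⟩ := (hl.mem_iff e).1 he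
    obtain rfl := huniq _ _ _ _ _ _ _ hm₁ ((h.op_eq hm₁).1.symm.trans ho') hm ho
    exact h.notMem_deps _ _ hm hk₁
  have v := TreeOp.valid_of_enabled en (hnew hm hl)
  have v' := TreeOp.valid_of_enabled en' (hnew hm' (hdeps ▸ hl))
  rw [hstate]
  rcases hcases with ⟨hlt, e⟩ | ⟨hlt, e⟩ <;> rw [e]
  · refine (Subtype.ext (TreeOp.apply_IT_of_before ((treeObject noValue).replay l).2 v v' ?_
      hlt)).symm
    rintro p₁ id p₂ _ ho ho' rfl
    obtain rfl := huniq _ _ _ _ _ _ _ hm ho hm' ho'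
    rw [hm] at hm'
    exact hne (by rw [Option.some.inj hm'])
  · rw [TreeOp.IT_eq_of_before hlt]

end Trees

/-! ### Projections of computations -/

namespace EditingAlgorithm

variable {O S O' S' : Type u}

/-- A projection of an algorithm `B` for `Y` to an algorithm `A` for `X`: some of the operations
and requests of `B` are operations and requests of `A`, and act as such on a part of the
environments of `B`, while the others leave this part unchanged. -/
structure Projection (B : EditingAlgorithm O' S') (Y : CollabObject O' S')
    (A : EditingAlgorithm O S) (X : CollabObject O S) where
  env : B.Env → A.Env
  op : O' → Option O
  req : B.Req → Option A.Req
  start : ∀ i, env (B.start i) = A.start i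
  req_eq : ∀ o E, req (B.request o E) = (op o).map fun o' => A.request o' (env E)
  localStep : ∀ o E, env (B.localStep o E) = (op o).elim (env E) fun o' => A.localStep o' (env E)
  remoteStep : ∀ r E,
    env (B.remoteStep r E) = (req r).elim (env E) fun r' => A.remoteStep r' (env E)
  enabled : ∀ i past E o o', Y.enabled i past (B.state E) o → op o = some o' →
    X.enabled i {a | ∃ b ∈ past, op b = some a} (A.state (env E)) o'

/-- The configuration `d` is what the projection `P` leaves of the configuration `c`. -/
structure IsProjection {B : EditingAlgorithm O' S'} {Y : CollabObject O' S'}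
    {A : EditingAlgorithm O S} {X : CollabObject O S} (P : Projection B Y A X)
    (c : B.Config) (d : A.Config) : Prop where
  env : ∀ i, d.env i = P.env (c.env i)
  done : ∀ i k, k ∈ d.done i ↔ k ∈ c.done i ∧ d.sent k ≠ none
  done_sent : ∀ i k, k ∈ c.done i → c.sent k ≠ none
  sent_none : ∀ k, c.sent k = none → d.sent k = none
  sent_some : ∀ k m, c.sent k = some m →
    (P.op m.op = none ∧ P.req m.req = none ∧ d.sent k = none) ∨
    ∃ o r D, P.op m.op = some o ∧ P.req m.req = some r ∧ d.sent k = some ⟨m.origin, o, r, D⟩ ∧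
      ∀ k' ∈ D, k' ∈ m.deps ∧ d.sent k' ≠ none

namespace IsProjection

variable {B : EditingAlgorithm O' S'} {Y : CollabObject O' S'} {A : EditingAlgorithm O S}
  {X : CollabObject O S} {P : Projection B Y A X} {c : B.Config} {d : A.Config}

theorem sent_of_op (h : IsProjection P c d) {k m o} (hm : c.sent k = some m)
    (ho : P.op m.op = some o) : ∃ m', d.sent k = some m' ∧ m'.op = o ∧ m'.origin = m.origin := by
  rcases h.sent_some k m hm with ⟨h, -⟩ | ⟨o', r, D, h, -, h', -⟩
  · rw [ho] at h; cases h
  · rw [ho] at h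
    exact ⟨_, h', (Option.some.inj h).symm, rfl⟩

theorem exists_sent (h : IsProjection P c d) {k m'} (hm' : d.sent k = some m') :
    ∃ m, c.sent k = some m ∧ P.op m.op = some m'.op ∧ m'.origin = m.origin := by
  cases hm : c.sent k with
  | none => rw [h.sent_none k hm] at hm'; cases hm'
  | some m =>
    rcases h.sent_some k m hm with ⟨-, -, h⟩ | ⟨o', r, D, h, -, h', -⟩
    · rw [h] at hm'; cases hm'
    · obtain rfl := Option.some.inj (h'.symm.trans hm')
      exact ⟨m, rfl, h, rfl⟩

theorem past_eq (h : IsProjection P c d) (i : Site) :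
    d.past i = {a | ∃ b ∈ c.past i, P.op b = some a} := by
  ext a
  constructor
  · rintro ⟨k, m', hm', rfl, rfl⟩
    obtain ⟨m, hm, ho, hi⟩ := h.exists_sent hm'
    exact ⟨m.op, ⟨k, m, hm, hi.symm, rfl⟩, ho⟩
  · rintro ⟨b, ⟨k, m, hm, rfl, rfl⟩, ho⟩
    obtain ⟨m', hm', ho', hi⟩ := h.sent_of_op hm ho
    exact ⟨k, m', hm', hi, ho'⟩

theorem complete (h : IsProjection P c d) {i : Site} (hi : c.Complete i) : d.Complete i := by
  intro k hk
  exact (h.done i k).2 ⟨hi k fun hn => hk (h.sent_none k hn), hk⟩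

theorem initial (P : Projection B Y A X) :
    IsProjection P (Config.initial B) (Config.initial A) where
  env i := (P.start i).symm
  done _ _ := by simp [Config.initial]
  done_sent _ _ h := h.elim
  sent_none _ _ := rfl
  sent_some _ _ h := by cases h

theorem generate_none (h : IsProjection P c d) {i : Site} {op : O'} {k : ℕ}
    (fresh : c.sent k = none) (ho : P.op op = none) :
    IsProjection P (c.generate i op k) d where
  env j := by
    rw [h.env j]
    by_cases hj : j = i
    · subst hj; simp [Config.generate, P.localStep, ho]
    · simp [Config.generate, hj]
  done j k' := by
    rw [h.done j k']
    have hk : d.sent k = none := h.sent_none k fresh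
    by_cases hj : j = i
    · subst hj
      by_cases hkk : k' = k
      · subst hkk; simp [hk]
      · simp [Config.generate, hkk]
    · simp [Config.generate, hj]
  done_sent j k' hk' := by
    by_cases hkk : k' = k
    · subst hkk; simp [Config.generate]
    · have : k' ∈ c.done j := by
        by_cases hj : j = i
        · subst hj; simpa [Config.generate, hkk] using hk'
        · simpa [Config.generate, hj] using hk'
      simpa [Config.generate, hkk] using h.done_sent j k' this
  sent_none k' hk' := by
    by_cases hkk : k' = k
    · subst hkk; exact h.sent_none _ fresh
    · simp only [Config.generate, Function.update_of_ne hkk] at hk'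
      exact h.sent_none k' hk'
  sent_some k' m hm := by
    by_cases hkk : k' = k
    · subst hkk
      simp only [Config.generate, Function.update_self, Option.some.injEq] at hm
      subst hm
      exact .inl ⟨ho, by simp [P.req_eq, ho], h.sent_none _ fresh⟩
    · simp only [Config.generate, Function.update_of_ne hkk] at hm
      exact h.sent_some k' m hm

theorem generate_some (h : IsProjection P c d) {i : Site} {op : O'} {o : O} {k : ℕ}
    (fresh : c.sent k = none) (ho : P.op op = some o) :
    IsProjection P (c.generate i op k) (d.generate i o k) where
  env j := by
    by_cases hj : j = i
    · subst hj; simp [Config.generate, P.localStep, ho, h.env]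
    · simp [Config.generate, hj, h.env]
  done j k' := by
    have hd := h.done j k'
    by_cases hkk : k' = k
    · subst hkk
      have hc : k' ∉ c.done j := fun hk => h.done_sent j k' hk fresh
      by_cases hj : j = i
      · subst hj; simp [Config.generate]
      · simp [Config.generate, hj, hc, hd]
    · by_cases hj : j = i
      · subst hj; simpa [Config.generate, hkk] using hd
      · simpa [Config.generate, hj, hkk] using hd
  done_sent j k' hk' := by
    by_cases hkk : k' = k
    · subst hkk; simp [Config.generate]
    · have : k' ∈ c.done j := by
        by_cases hj : j = i
        · subst hj; simpa [Config.generate, hkk] using hk'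
        · simpa [Config.generate, hj] using hk'
      simpa [Config.generate, hkk] using h.done_sent j k' this
  sent_none k' hk' := by
    by_cases hkk : k' = k
    · subst hkk; simp [Config.generate] at hk'
    · simp only [Config.generate, Function.update_of_ne hkk] at hk' ⊢
      exact h.sent_none k' hk'
  sent_some k' m hm := by
    have hold : ∀ k₁, d.sent k₁ ≠ none → (d.generate i o k).sent k₁ ≠ none := fun k₁ hk₁ => by
      by_cases hkk : k₁ = k
      · subst hkk; exact absurd (h.sent_none _ fresh) hk₁
      · simpa [Config.generate, hkk] using hk₁
    by_cases hkk : k' = k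
    · subst hkk
      simp only [Config.generate, Function.update_self, Option.some.injEq] at hm
      subst hm
      refine .inr ⟨o, A.request o (A.localStep o (d.env i)), d.done i, ho, ?_, ?_,
        fun k₁ hk₁ => ?_⟩
      · simp [P.req_eq, ho, P.localStep, h.env]
      · simp [Config.generate]
      · have := (h.done i k₁).1 hk₁
        exact ⟨this.1, hold _ this.2⟩
    · simp only [Config.generate, Function.update_of_ne hkk] at hm
      rcases h.sent_some k' m hm with ⟨h₁, h₂, h₃⟩ | ⟨o', r, D, h₁, h₂, h₃, h₄⟩
      · exact .inl ⟨h₁, h₂, by simpa [Config.generate, hkk] using h₃⟩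
      · exact .inr ⟨o', r, D, h₁, h₂, by simpa [Config.generate, hkk] using h₃,
          fun k₁ hk₁ => ⟨(h₄ k₁ hk₁).1, hold _ (h₄ k₁ hk₁).2⟩⟩

theorem receive_none (h : IsProjection P c d) {j : Site} {k : ℕ} {m} (hm : c.sent k = some m)
    (hr : P.req m.req = none) (hd : d.sent k = none) : IsProjection P (c.receive j k m) d where
  env i := by
    rw [h.env i]
    by_cases hj : i = j
    · subst hj; simp [Config.receive, P.remoteStep, hr]
    · simp [Config.receive, hj]
  done i k' := by
    rw [h.done i k']
    by_cases hj : i = j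
    · subst hj
      by_cases hkk : k' = k
      · subst hkk; simp [hd]
      · simp [Config.receive, hkk]
    · simp [Config.receive, hj]
  done_sent i k' hk' := by
    by_cases hkk : k' = k
    · subst hkk; simp [Config.receive, hm]
    · have : k' ∈ c.done i := by
        by_cases hj : i = j
        · subst hj; simpa [Config.receive, hkk] using hk'
        · simpa [Config.receive, hj] using hk'
      exact h.done_sent i k' this
  sent_none := h.sent_none
  sent_some := h.sent_some

theorem receive_some (h : IsProjection P c d) {j : Site} {k : ℕ} {m m'} (hm : c.sent k = some m)
    (hr : P.req m.req = some m'.req) (hd : d.sent k = some m') :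
    IsProjection P (c.receive j k m) (d.receive j k m') where
  env i := by
    by_cases hj : i = j
    · subst hj; simp [Config.receive, P.remoteStep, hr, h.env]
    · simp [Config.receive, hj, h.env]
  done i k' := by
    have := h.done i k'
    by_cases hkk : k' = k
    · subst hkk
      by_cases hj : i = j
      · subst hj; simp [Config.receive, hd]
      · simpa [Config.receive, hj] using this
    · by_cases hj : i = j
      · subst hj; simpa [Config.receive, hkk] using this
      · simpa [Config.receive, hj] using this
  done_sent i k' hk' := by
    by_cases hkk : k' = k
    · subst hkk; simp [Config.receive, hm]
    · have : k' ∈ c.done i := by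
        by_cases hj : i = j
        · subst hj; simpa [Config.receive, hkk] using hk'
        · simpa [Config.receive, hj] using hk'
      exact h.done_sent i k' this
  sent_none := h.sent_none
  sent_some := h.sent_some

/-- Every computation projects to a computation. -/
theorem exists_of_reachable (P : Projection B Y A X) (hc : Reachable Y B c) :
    ∃ d, Reachable X A d ∧ IsProjection P c d := by
  induction hc with
  | refl => exact ⟨_, .refl, initial P⟩
  | @tail c _ _ hs ih =>
    obtain ⟨d, hd, h⟩ := ih
    cases hs with
    | generate i op k fresh en =>
      cases ho : P.op op with
      | none => exact ⟨d, hd, h.generate_none fresh ho⟩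
      | some o =>
        refine ⟨_, hd.tail (.generate d i o k (h.sent_none k fresh) ?_), h.generate_some fresh ho⟩
        rw [h.past_eq, h.env]
        exact P.enabled i _ _ op o en ho
    | receive j k m hm new causal =>
      rcases h.sent_some k m hm with ⟨-, h₂, h₃⟩ | ⟨o, r, D, -, h₂, h₃, h₄⟩
      · exact ⟨d, hd, h.receive_none hm h₂ h₃⟩
      · refine ⟨_, hd.tail (.receive d j k _ h₃ (fun hk => new ((h.done j k).1 hk).1) ?_),
          h.receive_some hm h₂ h₃⟩
        exact fun k' hk' => (h.done j k').2 ⟨causal (h₄ k' hk').1, (h₄ k' hk').2⟩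

end IsProjection

end EditingAlgorithm

/-! ### Composition -/

namespace EditingAlgorithm

variable {Lab OD D : Type u} {noValue : Lab} {Y : CollabObject OD D}
  {AT : EditingAlgorithm (TreeOp Lab) (XTree Lab)} {AD : EditingAlgorithm OD D}

/-- The tree part of a composition. -/
noncomputable def treeProjection (noValue : Lab) (Y : CollabObject OD D)
    (AT : EditingAlgorithm (TreeOp Lab) (XTree Lab)) (AD : EditingAlgorithm OD D) :
    Projection (AT.compose AD Y.start) (decoratedObject noValue Y) AT (treeObject noValue) where
  env E := E.1
  op := Sum.elim some fun _ => none
  req := Sum.elim some fun _ => none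
  start _ := rfl
  req_eq o _ := by cases o <;> rfl
  localStep o _ := by cases o <;> rfl
  remoteStep r _ := by cases r <;> rfl
  enabled i past E o o' h ho := by
    cases o with
    | inr => cases ho
    | inl o =>
      obtain rfl := Option.some.inj ho
      have : {a | ∃ b ∈ past, Sum.elim some (fun _ => none) b = some a} =
          {a | .inl a ∈ past} := by
        ext a; simp
      rw [this]
      exact h

open Classical in
/-- The part of a composition that concerns the datum at the identifier `id`. -/
noncomputable def dataProjection (noValue : Lab) (Y : CollabObject OD D)
    (AT : EditingAlgorithm (TreeOp Lab) (XTree Lab)) (AD : EditingAlgorithm OD D) (id : Ident) :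
    Projection (AT.compose AD Y.start) (decoratedObject noValue Y) AD Y where
  env E := E.2 id
  op := Sum.elim (fun _ => none) fun o => if o.1 = id then some o.2 else none
  req := Sum.elim (fun _ => none) fun r => if r.1 = id then some r.2 else none
  start _ := rfl
  req_eq o E := by
    rcases o with o | ⟨id', o⟩
    · rfl
    · by_cases h : id' = id
      · subst h; simp [compose]
      · simp [compose, h]
  localStep o E := by
    rcases o with o | ⟨id', o⟩
    · rfl
    · by_cases h : id' = id
      · subst h; simp [compose]
      · simp [compose, h, Ne.symm h]
  remoteStep r E := by
    rcases r with r | ⟨id', r⟩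
    · rfl
    · by_cases h : id' = id
      · subst h; simp [compose]
      · simp [compose, h, Ne.symm h]
  enabled i past E o o' h ho := by
    rcases o with o | ⟨id', o⟩
    · cases ho
    · by_cases hid : id' = id
      · subst hid
        obtain rfl : o = o' := by simpa using ho
        obtain ⟨h₁, h₂⟩ := h
        have e₁ : {a | ∃ b ∈ past, Sum.elim (fun _ => none)
            (fun o : Ident × OD => if o.1 = id' then some o.2 else none) b = some a} =
            {a | .inr (id', a) ∈ past} := by
          ext a
          simp only [Set.mem_ofPred_eq]
          constructor
          · rintro ⟨b | ⟨id, b⟩, hb, e⟩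
            · cases e
            · by_cases hid : id = id'
              · subst hid
                obtain rfl : b = a := by simpa using e
                exact hb
              · simp [hid] at e
          · intro h
            exact ⟨_, h, by simp⟩
        have e₂ : ((AT.compose AD Y.start).state E).label id' = AD.state (E.2 id') := if_pos h₁
        rw [e₁]
        rwa [e₂] at h₂
      · simp [hid] at ho

theorem decorate_congr {d₀ : D} {t : XTree Lab} {δ δ' : Ident → D}
    (h : ∀ id ∈ t.dom, δ id = δ' id) : decorate d₀ t δ = decorate d₀ t δ' := by
  refine DecoratedTree.ext rfl (funext fun id => ?_)
  simp only [decorate]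
  split_ifs with hid
  · exact h id hid
  · rfl

theorem label_decorate_of_mem {d₀ : D} {t : XTree Lab} {δ : Ident → D} {id : Ident}
    (h : id ∈ t.dom) : (decorate d₀ t δ).label id = δ id := if_pos h

/-- Data at an identifier are edited only after the identifier has been added. -/
theorem exists_add_of_data_op (hT : AT.LosesNoOperation (treeObject noValue))
    {c : (AT.compose AD Y.start).Config}
    (hc : Reachable (decoratedObject noValue Y) (AT.compose AD Y.start) c) {k m id o}
    (hm : c.sent k = some m) (ho : m.op = .inr (.node id, o)) :
    ∃ k' m' p, c.sent k' = some m' ∧ m'.op = .inl (.add p id) := by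
  induction hc generalizing k m with
  | refl => cases hm
  | @tail c _ hc hs ih =>
    cases hs with
    | receive => exact ih hm ho
    | generate i op k₀ fresh en =>
      suffices ∃ k' m' p, c.sent k' = some m' ∧ m'.op = .inl (.add p id) by
        obtain ⟨k', m', p, hm', ho'⟩ := this
        have hk : k' ≠ k₀ := by rintro rfl; simp [fresh] at hm'
        exact ⟨k', m', p, by simpa [Config.generate, hk] using hm', ho'⟩
      by_cases hk : k = k₀
      · subst hk
        simp only [Config.generate, Function.update_self, Option.some.injEq] at hm
        subst hm
        obtain rfl : op = .inr (.node id, o) := ho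
        obtain ⟨d, hd, hproj⟩ :=
          IsProjection.exists_of_reachable (treeProjection noValue Y AT AD) hc
        obtain ⟨l, -, hl, -, hstate⟩ := hT d hd i
        have hdom : .node id ∈ (AT.state (d.env i)).dom := by
          rw [hproj.env]; exact en.1
        rw [hstate] at hdom
        obtain ⟨p, hp⟩ := exists_add_of_mem_run hdom
        obtain ⟨k', -, hk'⟩ := List.mem_filterMap.1 hp
        obtain ⟨m', hm', ho'⟩ := Option.map_eq_some_iff.1 hk'
        obtain ⟨m₁, hm₁, ho₁, -⟩ := hproj.exists_sent hm'
        refine ⟨k', m₁, p, hm₁, ?_⟩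
        rw [ho'] at ho₁
        revert ho₁
        cases m₁.op with
        | inl o => intro e; rw [Option.some.inj e]
        | inr => intro e; cases e
      · simp only [Config.generate, Function.update_of_ne hk] at hm
        exact ih hm ho

/-- An identifier that a site may add still carries the default datum everywhere: by the
preconditions nobody has added it, hence nobody has edited its datum. -/
theorem data_state_eq_start (hT : AT.LosesNoOperation (treeObject noValue))
    (hD : AD.LosesNoOperation Y) {c : (AT.compose AD Y.start).Config}
    (hc : Reachable (decoratedObject noValue Y) (AT.compose AD Y.start) c) {i : Site} {p id}
    (en : (decoratedObject noValue Y).enabled i (c.past i)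
      ((AT.compose AD Y.start).state (c.env i)) (.inl (.add p id))) :
    AD.state ((c.env i).2 (.node id)) = Y.start := by
  obtain ⟨d, hd, hproj⟩ := IsProjection.exists_of_reachable (treeProjection noValue Y AT AD) hc
  obtain ⟨d', hd', hproj'⟩ :=
    IsProjection.exists_of_reachable (dataProjection noValue Y AT AD (.node id)) hc
  obtain ⟨l, -, hl, -, hstate⟩ := hD d' hd' i
  have hnil : l = [] := by
    refine List.eq_nil_iff_forall_not_mem.2 fun k hk => ?_
    obtain ⟨m', hm'⟩ := Option.ne_none_iff_exists'.1 ((hproj'.done i k).1 ((hl k).1 hk)).2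
    obtain ⟨m, hm, ho, -⟩ := hproj'.exists_sent hm'
    have : ∃ o, m.op = .inr (.node id, o) := by
      revert ho
      rcases m.op with o | ⟨id', o⟩
      · intro e; cases e
      · intro e
        by_cases hid : id' = .node id
        · exact ⟨o, by rw [hid]⟩
        · simp [dataProjection, hid] at e
    obtain ⟨o, ho⟩ := this
    obtain ⟨k₁, m₁, q, hm₁, ho₁⟩ := exists_add_of_data_op hT hc hm ho
    obtain ⟨m₂, hm₂, ho₂, hi⟩ := hproj.sent_of_op hm₁ (o := .add q id) (by rw [ho₁]; rfl)
    have horigin := (add_origin_and_unique hd).1 k₁ m₂ q id hm₂ ho₂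
    exact en.2.1 q ⟨k₁, m₁, hm₁, hi.symm.trans (horigin.symm.trans en.1), ho₁⟩
  have e : (c.env i).2 (.node id) = d'.env i := (hproj'.env i).symm
  rw [e, hstate, hnil]
  rfl

/-- The composition of convergent algorithms that lose no operation is convergent. -/
theorem Convergent.compose (hT : AT.Convergent (treeObject noValue))
    (hT' : AT.LosesNoOperation (treeObject noValue)) (hD : AD.Convergent Y)
    (hD' : AD.LosesNoOperation Y) :
    (AT.compose AD Y.start).Convergent (decoratedObject noValue Y) where
  start_eq i := by
    change decorate _ (AT.state (AT.start i)) (fun _ => AD.state (AD.start i)) = _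
    simp only [hT.start_eq, hD.start_eq]
    rfl
  local_eq c hc i op en := by
    rcases op with o | ⟨id, o⟩
    · obtain ⟨d, hd, hproj⟩ :=
        IsProjection.exists_of_reachable (treeProjection noValue Y AT AD) hc
      have hloc := hT.local_eq d hd i o (by
        rw [hproj.past_eq, hproj.env]
        exact (treeProjection noValue Y AT AD).enabled i _ _ _ _ en rfl)
      rw [hproj.env] at hloc
      change AT.state (AT.localStep o (c.env i).1) =
        (treeObject noValue).exec (AT.state (c.env i).1) o at hloc
      change decorate _ (AT.state (AT.localStep o (c.env i).1))
          (fun id => AD.state ((c.env i).2 id)) =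
        decorate _ ((treeObject noValue).exec (AT.state (c.env i).1) o)
          (decorate _ (AT.state (c.env i).1) fun id => AD.state ((c.env i).2 id)).label
      rw [hloc]
      refine decorate_congr fun x hx => ?_
      by_cases hold : x ∈ (AT.state (c.env i).1).dom
      · rw [label_decorate_of_mem hold]
      · rw [DecoratedTree.label_default _ _ hold]
        rcases TreeOp.mem_ids_of_mem_apply hx with h | ⟨p, id, rfl, rfl⟩
        · exact absurd h hold
        · exact data_state_eq_start hT' hD' hc en
    · obtain ⟨d, hd, hproj⟩ :=
        IsProjection.exists_of_reachable (dataProjection noValue Y AT AD id) hc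
      have hloc := hD.local_eq d hd i o (by
        rw [hproj.past_eq, hproj.env]
        exact (dataProjection noValue Y AT AD id).enabled i _ _ _ _ en (if_pos rfl))
      rw [hproj.env] at hloc
      change AD.state (AD.localStep o ((c.env i).2 id)) =
        Y.exec (AD.state ((c.env i).2 id)) o at hloc
      change decorate _ (AT.state (c.env i).1) (fun x => AD.state
          (Function.update (c.env i).2 id (AD.localStep o ((c.env i).2 id)) x)) =
        decorate _ (AT.state (c.env i).1) (Function.update
          (decorate _ (AT.state (c.env i).1) fun x => AD.state ((c.env i).2 x)).label id
          (Y.exec ((decorate _ (AT.state (c.env i).1) fun x =>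
            AD.state ((c.env i).2 x)).label id) o))
      have hid : id ∈ (AT.state (c.env i).1).dom := en.1
      refine decorate_congr fun x hx => ?_
      rw [label_decorate_of_mem hid, ← hloc]
      by_cases h : x = id
      · subst h; simp only [Function.update_self]
      · simp only [Function.update_of_ne h]
        rw [label_decorate_of_mem hx]
  agree c hc i j hi hj := by
    change decorate _ (AT.state (c.env i).1) (fun id => AD.state ((c.env i).2 id)) =
      decorate _ (AT.state (c.env j).1) (fun id => AD.state ((c.env j).2 id))
    obtain ⟨d, hd, hproj⟩ := IsProjection.exists_of_reachable (treeProjection noValue Y AT AD) hc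
    have htree := hT.agree d hd i j (hproj.complete hi) (hproj.complete hj)
    rw [hproj.env, hproj.env] at htree
    have hdata : ∀ id, AD.state ((c.env i).2 id) = AD.state ((c.env j).2 id) := fun id => by
      obtain ⟨d', hd', hproj'⟩ :=
        IsProjection.exists_of_reachable (dataProjection noValue Y AT AD id) hc
      have := hD.agree d' hd' i j (hproj'.complete hi) (hproj'.complete hj)
      rwa [hproj'.env, hproj'.env] at this
    exact congrArg₂ (decorate _) htree (funext hdata)

end EditingAlgorithm

theorem mainTheorem3 {Lab Sym : Type u} (noValue : Lab) :
    ∃ (AT : EditingAlgorithm (TreeOp Lab) (XTree Lab))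
      (AD : EditingAlgorithm (WordOp Sym) (List Sym)),
      (AT.Convergent (treeObject noValue) ∧ AT.LosesNoOperation (treeObject noValue) ∧
        AT.IntegratesBy (treeObject noValue) TreeOp.IT) ∧
      (AD.Convergent (wordObject Sym) ∧ AD.LosesNoOperation (wordObject Sym)) ∧
      (AT.compose AD []).Convergent (documentObject noValue Sym) :=
  have hT := replay_convergent (treeObject noValue) TreeOp.rank
  have hT' := replay_losesNoOperation (treeObject noValue) TreeOp.rank
  have hD := replay_convergent (wordObject Sym) fun _ => 0
  have hD' := replay_losesNoOperation (wordObject Sym) fun _ => 0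
  ⟨_, _, ⟨hT, hT', replay_integratesBy⟩, ⟨hD, hD'⟩, hT.compose hT' hD hD'⟩
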